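/- Let $n\ge 2$ and let $\sigma$ be the surface measure on the unit sphere $S^{n-1}\subset\mathbb R^n$. Let $\Delta_\omega=\sum_{i<j}\Omega_{ij}^2$, $\Omega_{ij}=x_i\partial_j-x_j\partial_i$, be the Laplace–Beltrami operator on $S^{n-1}$, and let $\Lambda_\omega=\sqrt{1-\Delta_\omega}$. For $s\in\mathbb R$ let $H^s_\omega=\Lambda_\omega^{-s}L^2(S^{n-1})$ with norm $\|g\|_{H^s_\omega}=\|\Lambda_\omega^{s}g\|_{L^2(S^{n-1})}$ (for $s<0$ its elements are distributions on $S^{n-1}$). Let $\widehat{g\,d\sigma}(x)=\int_{S^{n-1}}e^{-ix\cdot\omega}g(\omega)\,d\sigma(\omega)$, where for a distribution $g$ the integral is the action of $g$ on $\omega\mapsto e^{-ix\cdot\omega}$. For functions $F$ of $x=r\omega\in\mathbb R^n$ the operator $\Lambda_\omega^s$ acts in the variable $\omega$, so that $\|\Lambda_\omega^sF\|_{L^2(\mathbb R^n)}^2=\int_0^\infty\|F(r\,\cdot)\|_{H^s_\omega}^2\,r^{n-1}\,dr$. 1. If $b\in(1,n)$, there are constants $0<c,C<\infty$, depending only on $n$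 and $b$, such that for every $g\in L^2(S^{n-1})$ $$c\,\|g\|_{L^2(S^{n-1})}\le\big\|\Lambda_\omega^{\frac{b-1}{2}}|x|^{-\frac b2}\,\widehat{g\,d\sigma}\big\|_{L^2(\mathbb R^n)}\le C\,\|g\|_{L^2(S^{n-1})}.$$ 2. If $b\in(1,n)$, there is a constant $C<\infty$, depending only on $n$ and $b$, such that for every $s\ge\frac{1-b}{2}$ and every $g\in H^s_\omega$ $$\big\||x|^{-\frac b2}\,\widehat{g\,d\sigma}\big\|_{L^2(\mathbb R^n)}\le C\,\|g\|_{H^s_\omega}.$$ 3. The condition on $b$ is necessary. Let $b\in\mathbb R$. If there is a constant $C<\infty$ such that the upper bound in 1 holds for all $g\in L^2(S^{n-1})$, then $b\in(1,n)$. If for some $s\in\mathbb R$ there is a constant $C<\infty$ such that the inequality in 2 holds for all $g\in L^2(S^{n-1})\cap H^s_\omega$, then $b\in(1,n)$. -/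

import Mathlib

open scoped ENNReal NNReal

noncomputable section

namespace SphereTrace

/-- The unit sphere `S^{n-1}` of `ℝⁿ`. -/
abbrev Sph (n : ℕ) : Type := Metric.sphere (0 : EuclideanSpace ℝ (Fin n)) 1

/-- The surface measure `dσ` on `S^{n-1}` (not normalized: the total mass is `n · |B(0,1)|`). -/
abbrev surf (n : ℕ) : MeasureTheory.Measure (Sph n) :=
  (MeasureTheory.volume : MeasureTheory.Measure (EuclideanSpace ℝ (Fin n))).toSphere

/-- The complex Hilbert space `L²(S^{n-1}, dσ)`. -/
abbrev L2Sph (n : ℕ) : Type := MeasureTheory.Lp ℂ 2 (surf n)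

/-- The rotation field `Ω_{ij} = x_i ∂_j - x_j ∂_i`. It is tangent to every sphere centred at the
origin, so that `Ω_{ij} φ` on `S^{n-1}` depends only on `φ` restricted to `S^{n-1}`. -/
def rot {n : ℕ} (i j : Fin n) (φ : EuclideanSpace ℝ (Fin n) → ℂ)
    (x : EuclideanSpace ℝ (Fin n)) : ℂ :=
  (x i : ℂ) * fderiv ℝ φ x (EuclideanSpace.single j 1)
    - (x j : ℂ) * fderiv ℝ φ x (EuclideanSpace.single i 1)

/-- The Laplace-Beltrami operator `Δ_ω = ∑_{i<j} Ω_{ij}²`, on smooth functions. (The smooth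
functions on the sphere are the restrictions of the smooth functions on `ℝⁿ`.) -/
def lapBeltrami {n : ℕ} (φ : EuclideanSpace ℝ (Fin n) → ℂ)
    (x : EuclideanSpace ℝ (Fin n)) : ℂ :=
  ∑ i : Fin n, ∑ j : Fin n, if i < j then rot i j (rot i j φ) x else 0

/-- The `L²` classes of the restrictions to the sphere of `Δ_ω φ + lam φ`, for `φ` smooth. -/
def shiftedRange (n : ℕ) (lam : ℝ) : Set (L2Sph n) :=
  {u | ∃ φ : EuclideanSpace ℝ (Fin n) → ℂ, ContDiff ℝ ((⊤ : ℕ∞) : WithTop ℕ∞) φ ∧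
    ⇑u =ᵐ[surf n] fun ω => lapBeltrami φ (ω : EuclideanSpace ℝ (Fin n)) + (lam : ℂ) * φ ω}

/-- The eigenspace of `-Δ_ω` in `L²(S^{n-1})` for `lam`: all `f ∈ L²` with `-Δ_ω f = lam f` in the
sense of distributions, that is `∫ conj (Δ_ω φ + lam φ) f dσ = 0` for every smooth `φ`. -/
def eigenspace (n : ℕ) (lam : ℝ) : Submodule ℂ (L2Sph n) :=
  (Submodule.span ℂ (shiftedRange n lam))ᗮ

instance (n : ℕ) (lam : ℝ) : (eigenspace n lam).HasOrthogonalProjection :=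
  haveI : CompleteSpace (eigenspace n lam) :=
    (Submodule.isClosed_orthogonal _).completeSpace_coe
  inferInstance

/-- The orthogonal projection `P_lam` of `L²(S^{n-1})` onto the eigenspace of `-Δ_ω`. -/
def proj (n : ℕ) (lam : ℝ) : L2Sph n →L[ℂ] L2Sph n :=
  (eigenspace n lam).starProjection

/-- The domain of `Λ_ω^s`, where `Λ_ω = (1 - Δ_ω)^{1/2}`, as an operator in `L²(S^{n-1})`. -/
def angDomain (n : ℕ) (s : ℝ) : Set (L2Sph n) :=
  {f | Summable fun lam : ℝ≥0 => (1 + (lam : ℝ)) ^ s * ‖proj n lam f‖ ^ 2}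

/-- The operator `Λ_ω^s` with `Λ_ω = (1 - Δ_ω)^{1/2}`, by the functional calculus of `-Δ_ω`, which
has pure point spectrum in `[0, ∞)`: `Λ_ω^s f = ∑_lam (1 + lam)^{s/2} P_lam f`. The value is
meaningful for `f` in `angDomain n s`. -/
def angPow (n : ℕ) (s : ℝ) (f : L2Sph n) : L2Sph n :=
  ∑' lam : ℝ≥0, (((1 + (lam : ℝ)) ^ (s / 2) : ℝ) : ℂ) • proj n lam f

open Classical in
/-- The norm `‖f‖_{H^s_ω} = ‖Λ_ω^s f‖_{L²(S^{n-1})}` of `f ∈ L²(S^{n-1})`, and `∞` outside the domain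
of `Λ_ω^s`. -/
def sobNorm (n : ℕ) (s : ℝ) (f : L2Sph n) : ℝ≥0∞ :=
  if f ∈ angDomain n s then ‖angPow n s f‖ₑ else ⊤

open Classical in
/-- `sobNorm` for a function on the sphere; it is `∞` if the function is not in `L²`. -/
def sobNormFun (n : ℕ) (s : ℝ) (f : Sph n → ℂ) : ℝ≥0∞ :=
  if hf : MeasureTheory.MemLp f 2 (surf n) then sobNorm n s (hf.toLp f) else ⊤

/-- The norm `‖Λ_ω^s F‖_{L²(ℝⁿ)}`, where `Λ_ω` acts in the angular variable of `x = r ω`; in polar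
coordinates its square is `∫_0^∞ ‖Λ_ω^s F(r ·)‖²_{L²(S^{n-1})} r^{n-1} dr`. -/
def angL2Norm (n : ℕ) (s : ℝ) (F : EuclideanSpace ℝ (Fin n) → ℂ) : ℝ≥0∞ :=
  (∫⁻ r in Set.Ioi (0 : ℝ),
    sobNormFun n s (fun ω => F (r • (ω : EuclideanSpace ℝ (Fin n)))) ^ 2
      * ENNReal.ofReal (r ^ (n - 1))) ^ (1 / 2 : ℝ)

/-- The plane wave `e_x(ω) = e^{-i x·ω}` on the sphere. -/
def planeWave {n : ℕ} (x : EuclideanSpace ℝ (Fin n)) (ω : Sph n) : ℂ :=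
  Complex.exp (-(Complex.I * ((inner ℝ x (ω : EuclideanSpace ℝ (Fin n)) : ℝ) : ℂ)))

/-- The plane wave is continuous on the sphere, hence in `L²`. -/
theorem memLp_planeWave {n : ℕ} (x : EuclideanSpace ℝ (Fin n)) :
    MeasureTheory.MemLp (planeWave x) 2 (surf n) := by
  have hc : Continuous (planeWave x) := by
    unfold planeWave
    fun_prop
  refine MeasureTheory.MemLp.of_bound hc.aestronglyMeasurable 1 (Filter.Eventually.of_forall ?_)
  intro ω
  rw [planeWave, Complex.norm_exp]
  simp

/-- The plane wave as an element of `L²(S^{n-1})`. -/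
def planeWaveL2 {n : ℕ} (x : EuclideanSpace ℝ (Fin n)) : L2Sph n :=
  (memLp_planeWave x).toLp (planeWave x)

/-- The Fourier transform of the measure `g dσ`: `x ↦ ∫ e^{-i x·ω} g(ω) dσ(ω)`. -/
def fourierSurf {n : ℕ} (g : L2Sph n) (x : EuclideanSpace ℝ (Fin n)) : ℂ :=
  ∫ ω, planeWave x ω * g ω ∂(surf n)

/-- The Fourier transform of `g dσ` for the general element `g = Λ_ω^{-s} h`, `h ∈ L²(S^{n-1})`, of
`H^s_ω = Λ_ω^{-s} L²_ω`. For `s < 0` this `g` is a distribution on the sphere, and it acts on a smooth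
function `φ` as `∫ h Λ_ω^{-s} φ dσ`; the Fourier transform at `x` is its action on `e_x`. -/
def fourierSurfSob {n : ℕ} (s : ℝ) (h : L2Sph n) (x : EuclideanSpace ℝ (Fin n)) : ℂ :=
  ∫ ω, (angPow n (-s) (planeWaveL2 x)) ω * h ω ∂(surf n)

/-- The function `|x|^{-b/2} G(x)`. -/
def weighted {n : ℕ} (b : ℝ) (G : EuclideanSpace ℝ (Fin n) → ℂ)
    (x : EuclideanSpace ℝ (Fin n)) : ℂ :=
  ((‖x‖ ^ (-b / 2) : ℝ) : ℂ) * G x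

end SphereTrace

end

/-!
Write `f_k` for the component of `f ∈ L²(S^{n-1})` in the spherical harmonics of degree `k`, on
which `-Δ_ω` is `k (k + n - 2)`. By the Funk–Hecke formula, `g ↦ ĝdσ(r ·)` acts on the degree `k`
as a scalar of modulus `(2π)^{n/2} r^{1 - n/2} |J_ν(r)|` with `ν = n/2 - 1 + k`, whence
`‖Λ_ω^s |x|^{-b/2} ĝdσ‖² = (2π)ⁿ ∑_k (1 + k (k + n - 2))^s M(ν) ‖g_k‖²` with the moment
`M(ν) = ∫_0^∞ r^{1-b} J_ν(r)² dr`.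

Since `J_ν² ~ c r^{2ν}` at the origin, and `r (J_ν² + J_{ν+1}²)` is bounded above and below at
infinity by an energy argument, `M(ν)` and `M(ν + 1)` are both finite exactly for `1 < b < 2ν + 2`,
and testing on harmonics of degree `0` and `1` gives the necessity of `1 < b < n`. In this range,
integrating the derivative of `r^{2-b} (J_ν² + J_{ν+1}²)` yields
`(2ν + b) M(ν + 1) = (2ν + 2 - b) M(ν)`, so that `M` is a quotient of Gamma functions and
`k^{b-1} M(ν)` has a positive limit as `k → ∞`. A distribution `g = Λ_ω^{-s} h` is the limit of its
truncations to finitely many degrees, to which Fatou's lemma applies.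
-/

noncomputable section

namespace SphereTrace

open MeasureTheory Filter Set Topology

section Bessel

variable {ν b r : ℝ}

/-- The entire function `F_ν(z) = ∑ zᵐ / (m! Γ(ν + m + 1))`, for which
`J_ν(r) = (r/2)^ν F_ν(-r²/4)`. `Real.Gamma` is `0` at its poles, hence so are the terms with a
pole, as they should be. -/
def besselSeries (ν z : ℝ) : ℝ := ∑' m : ℕ, z ^ m / (m.factorial * Real.Gamma (ν + m + 1))

/-- The Bessel function `J_ν` of the first kind of real order, to be used on `(0, ∞)`. -/
def besselJ (ν r : ℝ) : ℝ := (r / 2) ^ ν * besselSeries ν (-(r ^ 2 / 4))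

theorem inv_Gamma_eq_mul_inv_Gamma_add_one (s : ℝ) :
    (Real.Gamma s)⁻¹ = s * (Real.Gamma (s + 1))⁻¹ := by
  rcases eq_or_ne s 0 with rfl | hs
  · simp
  · rw [Real.Gamma_add_one hs, mul_inv, mul_inv_cancel_left₀ hs]

theorem summable_besselSeries (ν z : ℝ) :
    Summable fun m : ℕ => z ^ m / (m.factorial * Real.Gamma (ν + m + 1)) := by
  refine summable_of_ratio_norm_eventually_le (r := 1 / 2) (by norm_num) ?_
  filter_upwards [tendsto_natCast_atTop_atTop.eventually_ge_atTop (2 * |z|),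
    tendsto_natCast_atTop_atTop.eventually_ge_atTop (-ν)] with m hz hν
  have hν1 : 1 ≤ ν + m + 1 := by linarith
  have hm : (m : ℝ) + 1 ≠ 0 := by positivity
  have hratio : z ^ (m + 1) / ((m + 1).factorial * Real.Gamma (ν + (m + 1 : ℕ) + 1)) =
      z / ((m + 1) * (ν + m + 1)) * (z ^ m / (m.factorial * Real.Gamma (ν + m + 1))) := by
    rw [Nat.factorial_succ, show ν + (m + 1 : ℕ) + 1 = ν + m + 1 + 1 by push_cast; ring,
      Real.Gamma_add_one (by linarith)]
    push_cast
    field_simp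
    exact pow_succ' z m
  rw [hratio, norm_mul]
  gcongr
  rw [norm_div, Real.norm_eq_abs, Real.norm_of_nonneg (by positivity), div_le_iff₀ (by positivity)]
  nlinarith [abs_nonneg z]

theorem natCast_mul_besselSeries_term (ν z : ℝ) (m : ℕ) :
    ((m + 1 : ℕ) : ℝ) * z ^ m / ((m + 1).factorial * Real.Gamma (ν + (m + 1 : ℕ) + 1)) =
      z ^ m / (m.factorial * Real.Gamma (ν + 1 + m + 1)) := by
  rw [Nat.factorial_succ, show ν + (m + 1 : ℕ) + 1 = ν + 1 + m + 1 by push_cast; ring]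
  push_cast
  have : (m : ℝ) + 1 ≠ 0 := by positivity
  field_simp

theorem hasDerivAt_besselSeries (ν z : ℝ) :
    HasDerivAt (besselSeries ν) (besselSeries (ν + 1) z) z := by
  set R : ℝ := ‖z‖ + 1
  let deriv (m : ℕ) (y : ℝ) : ℝ := m * y ^ (m - 1) / (m.factorial * Real.Gamma (ν + m + 1))
  have hderiv (m : ℕ) (y : ℝ) :
      deriv (m + 1) y = y ^ m / (m.factorial * Real.Gamma (ν + 1 + m + 1)) :=
    natCast_mul_besselSeries_term ν y m
  have hsummable (y : ℝ) : Summable fun m => deriv m y := by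
    rw [← summable_nat_add_iff 1]
    simpa only [hderiv] using summable_besselSeries (ν + 1) y
  have hbound (m : ℕ) (y : ℝ) (hy : y ∈ Metric.ball 0 R) : ‖deriv m y‖ ≤ ‖deriv m R‖ := by
    have hyR : ‖y‖ ≤ ‖R‖ := by
      rw [Real.norm_of_nonneg (by positivity : 0 ≤ R)]
      exact (mem_ball_zero_iff.1 hy).le
    simp only [deriv, norm_div, norm_mul, norm_pow]
    gcongr
  refine (hasDerivAt_tsum_of_isPreconnected (hsummable R).norm Metric.isOpen_ball
    (convex_ball (0 : ℝ) R).isPreconnected (fun m y _ => (hasDerivAt_pow m y).div_const _) hbound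
    (y₀ := z) (by simp [R]) (summable_besselSeries ν z) (by simp [R])).congr_deriv ?_
  rw [(hsummable z).tsum_eq_zero_add, besselSeries]
  simp only [hderiv]
  simp [deriv]

theorem continuous_besselSeries (ν : ℝ) : Continuous (besselSeries ν) :=
  continuous_iff_continuousAt.2 fun z => (hasDerivAt_besselSeries ν z).continuousAt

theorem besselSeries_zero_right (ν : ℝ) : besselSeries ν 0 = (Real.Gamma (ν + 1))⁻¹ := by
  rw [besselSeries, tsum_eq_single 0 fun m hm => by simp [hm]]
  simp

theorem besselSeries_recurrence (ν z : ℝ) :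
    besselSeries ν z = z * besselSeries (ν + 2) z + (ν + 1) * besselSeries (ν + 1) z := by
  have hshift : HasSum
      (fun m : ℕ => (m : ℝ) * (z ^ m / (m.factorial * Real.Gamma (ν + 1 + m + 1))))
      (z * besselSeries (ν + 2) z) := by
    rw [← hasSum_nat_add_iff' 1, Finset.sum_range_one, Nat.cast_zero, zero_mul, sub_zero]
    refine ((summable_besselSeries (ν + 2) z).hasSum.mul_left z).congr_fun fun m => ?_
    rw [← mul_div_assoc, pow_succ', mul_left_comm, mul_div_assoc,
      natCast_mul_besselSeries_term (ν + 1), show ν + 1 + 1 = ν + 2 by ring]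
  refine ((hshift.add ((summable_besselSeries (ν + 1) z).hasSum.mul_left (ν + 1))).congr_fun
    fun m => ?_).tsum_eq
  have hGamma := inv_Gamma_eq_mul_inv_Gamma_add_one (ν + m + 1)
  rw [show ν + 1 + m + 1 = ν + m + 1 + 1 by ring, div_mul_eq_div_div,
    div_eq_mul_inv _ (Real.Gamma _), hGamma]
  ring

theorem hasDerivAt_besselJ (ν : ℝ) (hr : 0 < r) :
    HasDerivAt (besselJ ν) (ν / r * besselJ ν r - besselJ (ν + 1) r) r := by
  have hinner : HasDerivAt (fun r : ℝ => -(r ^ 2 / 4)) (-(r / 2)) r :=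
    (((hasDerivAt_pow 2 r).div_const 4).neg).congr_deriv (by push_cast; ring)
  have hpow : HasDerivAt (fun r : ℝ => (r / 2) ^ ν) (1 / 2 * ν * (r / 2) ^ (ν - 1)) r :=
    ((hasDerivAt_id r).div_const 2).rpow_const (Or.inl (by positivity))
  refine (hpow.mul ((hasDerivAt_besselSeries ν _).comp r hinner)).congr_deriv ?_
  rw [besselJ, besselJ, Real.rpow_sub_one (by positivity), Real.rpow_add_one (by positivity),
    Function.comp_apply]
  field_simp
  ring

theorem besselJ_add_besselJ_add_two (ν : ℝ) (hr : 0 < r) :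
    besselJ ν r + besselJ (ν + 2) r = 2 * (ν + 1) / r * besselJ (ν + 1) r := by
  have hr2 : 0 < r / 2 := by positivity
  rw [besselJ, besselJ, besselJ, besselSeries_recurrence ν, Real.rpow_add_one hr2.ne',
    Real.rpow_add hr2, Real.rpow_two]
  field_simp
  ring

theorem hasDerivAt_besselJ_add_one (ν : ℝ) (hr : 0 < r) :
    HasDerivAt (besselJ (ν + 1)) (besselJ ν r - (ν + 1) / r * besselJ (ν + 1) r) r := by
  refine (hasDerivAt_besselJ (ν + 1) hr).congr_deriv ?_
  rw [show ν + 1 + 1 = ν + 2 by ring]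
  linear_combination -besselJ_add_besselJ_add_two ν hr

theorem measurable_besselJ (ν : ℝ) : Measurable (besselJ ν) :=
  ((measurable_id.div_const 2).pow_const ν).mul
    ((continuous_besselSeries ν).comp (by fun_prop)).measurable

theorem rpow_mul_besselJ_sq (p : ℝ) (hr : 0 < r) :
    r ^ p * besselJ ν r ^ 2 =
      r ^ (p + 2 * ν) * ((1 / 2) ^ ν * besselSeries ν (-(r ^ 2 / 4))) ^ 2 := by
  rw [besselJ, div_eq_mul_one_div, Real.mul_rpow hr.le (by norm_num), Real.rpow_add hr,
    two_mul, Real.rpow_add hr]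
  ring

theorem continuous_half_rpow_mul_besselSeries (ν : ℝ) :
    Continuous fun r : ℝ => ((1 / 2) ^ ν * besselSeries ν (-(r ^ 2 / 4))) ^ 2 :=
  (continuous_const.mul ((continuous_besselSeries ν).comp (by fun_prop))).pow 2

theorem exists_rpow_le_besselJ_sq (hν : -1 < ν) :
    ∃ c > 0, ∃ δ > 0, ∀ r ∈ Ioo 0 δ, c * r ^ (2 * ν) ≤ besselJ ν r ^ 2 := by
  set G : ℝ → ℝ := fun r => ((1 / 2) ^ ν * besselSeries ν (-(r ^ 2 / 4))) ^ 2
  have hG0 : 0 < G 0 := by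
    have : 0 < Real.Gamma (ν + 1) := Real.Gamma_pos_of_pos (by linarith)
    simp only [G, ne_eq, OfNat.ofNat_ne_zero, not_false_eq_true, zero_pow, zero_div, neg_zero,
      besselSeries_zero_right]
    positivity
  have hlarge : ∀ᶠ r in 𝓝[>] (0 : ℝ), G 0 / 2 < G r :=
    ((continuous_half_rpow_mul_besselSeries ν).continuousAt.eventually
      (lt_mem_nhds (half_lt_self hG0))).filter_mono nhdsWithin_le_nhds
  obtain ⟨δ, hδ, h⟩ := mem_nhdsGT_iff_exists_Ioo_subset.1 hlarge
  refine ⟨G 0 / 2, by positivity, δ, hδ, fun r hr => ?_⟩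
  have hr0 : 0 < r := hr.1
  have hJ := rpow_mul_besselJ_sq (ν := ν) 0 hr0
  rw [Real.rpow_zero, one_mul, zero_add] at hJ
  rw [hJ, mul_comm]
  gcongr
  exact (h hr).le

end Bessel

section BesselEnergy

variable {ν b r s : ℝ}

/-- The energy `r (J_ν² + J_{ν+1}²)`, which tends to a positive limit at infinity. -/
def besselEnergy (ν r : ℝ) : ℝ := r * (besselJ ν r ^ 2 + besselJ (ν + 1) r ^ 2)

/-- The energy with the lower order correction that makes its logarithmic derivative integrable
at infinity. -/
def besselModEnergy (ν r : ℝ) : ℝ :=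
  besselEnergy ν r - (2 * ν + 1) * (besselJ ν r * besselJ (ν + 1) r)

theorem besselEnergy_nonneg (ν : ℝ) (hr : 0 < r) : 0 ≤ besselEnergy ν r := by
  unfold besselEnergy; positivity

theorem hasDerivAt_rpow_mul_besselJ_sq_add (ν p : ℝ) (hr : 0 < r) :
    HasDerivAt (fun r => r ^ (p + 1) * (besselJ ν r ^ 2 + besselJ (ν + 1) r ^ 2))
      (r ^ p * ((p + 1 + 2 * ν) * besselJ ν r ^ 2 - (2 * ν + 1 - p) * besselJ (ν + 1) r ^ 2))
      r := by
  have hpow := Real.hasDerivAt_rpow_const (p := p + 1) (Or.inl hr.ne')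
  refine (hpow.mul (((hasDerivAt_besselJ ν hr).pow 2).add
    ((hasDerivAt_besselJ_add_one ν hr).pow 2))).congr_deriv ?_
  rw [add_sub_cancel_right, Real.rpow_add_one hr.ne']
  simp only [Pi.add_apply, Pi.pow_apply]
  push_cast
  field_simp
  ring

theorem hasDerivAt_besselModEnergy (ν : ℝ) (hr : 0 < r) :
    HasDerivAt (besselModEnergy ν) ((2 * ν + 1) / r * (besselJ ν r * besselJ (ν + 1) r)) r := by
  have henergy : HasDerivAt (besselEnergy ν)
      ((1 + 2 * ν) * besselJ ν r ^ 2 - (2 * ν + 1) * besselJ (ν + 1) r ^ 2) r := by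
    have h := hasDerivAt_rpow_mul_besselJ_sq_add ν 0 hr
    simp only [zero_add, Real.rpow_one, Real.rpow_zero, one_mul, sub_zero] at h
    exact h
  refine (henergy.sub (((hasDerivAt_besselJ ν hr).mul
    (hasDerivAt_besselJ_add_one ν hr)).const_mul (2 * ν + 1))).congr_deriv ?_
  field_simp
  ring

theorem abs_besselJ_mul_besselJ_le (ν : ℝ) (hr : 0 < r) :
    |besselJ ν r * besselJ (ν + 1) r| ≤ besselEnergy ν r / (2 * r) := by
  have h := two_mul_le_add_sq |besselJ ν r| |besselJ (ν + 1) r|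
  rw [sq_abs, sq_abs, mul_assoc, ← abs_mul] at h
  rw [besselEnergy, mul_comm 2 r, mul_div_mul_left _ _ hr.ne']
  linarith

theorem abs_besselModEnergy_sub_le (hν : -(1 / 2) < ν) (hr : 2 * ν + 1 ≤ r) :
    |besselModEnergy ν r - besselEnergy ν r| ≤ besselEnergy ν r / 2 := by
  have hκ : 0 < 2 * ν + 1 := by linarith
  have hr0 : 0 < r := hκ.trans_le hr
  calc |besselModEnergy ν r - besselEnergy ν r|
      = (2 * ν + 1) * |besselJ ν r * besselJ (ν + 1) r| := by
        rw [besselModEnergy, sub_sub_cancel_left, abs_neg, abs_mul, abs_of_pos hκ]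
    _ ≤ r * (besselEnergy ν r / (2 * r)) := by
        gcongr
        exact abs_besselJ_mul_besselJ_le ν hr0
    _ = besselEnergy ν r / 2 := by field_simp

theorem half_besselEnergy_le_besselModEnergy (hν : -(1 / 2) < ν) (hr : 2 * ν + 1 ≤ r) :
    besselEnergy ν r / 2 ≤ besselModEnergy ν r := by
  linarith [(abs_le.1 (abs_besselModEnergy_sub_le hν hr)).1]

theorem besselModEnergy_le (hν : -(1 / 2) < ν) (hr : 2 * ν + 1 ≤ r) :
    besselModEnergy ν r ≤ 3 / 2 * besselEnergy ν r := by
  linarith [(abs_le.1 (abs_besselModEnergy_sub_le hν hr)).2]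

theorem abs_deriv_besselModEnergy_le (hν : -(1 / 2) < ν) (hr : 2 * ν + 1 ≤ r) :
    |(2 * ν + 1) / r * (besselJ ν r * besselJ (ν + 1) r)| ≤
      (2 * ν + 1) / r ^ 2 * besselModEnergy ν r := by
  have hκ : 0 < 2 * ν + 1 := by linarith
  have hr0 : 0 < r := hκ.trans_le hr
  calc |(2 * ν + 1) / r * (besselJ ν r * besselJ (ν + 1) r)|
      = (2 * ν + 1) / r * |besselJ ν r * besselJ (ν + 1) r| := by
        rw [abs_mul, abs_of_pos (by positivity)]
    _ ≤ (2 * ν + 1) / r * (besselEnergy ν r / (2 * r)) := by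
        gcongr
        exact abs_besselJ_mul_besselJ_le ν hr0
    _ = (2 * ν + 1) / r ^ 2 * (besselEnergy ν r / 2) := by field_simp
    _ ≤ _ := by
        gcongr
        exact half_besselEnergy_le_besselModEnergy hν hr

theorem hasDerivAt_besselModEnergy_mul_exp (ν c : ℝ) (hr : 0 < r) :
    HasDerivAt (fun r => besselModEnergy ν r * Real.exp (c / r))
      (((2 * ν + 1) / r * (besselJ ν r * besselJ (ν + 1) r) - c / r ^ 2 * besselModEnergy ν r) *
        Real.exp (c / r)) r := by
  have hexp : HasDerivAt (fun r => Real.exp (c / r)) (Real.exp (c / r) * (c * -(r ^ 2)⁻¹)) r :=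
    ((hasDerivAt_inv hr.ne').const_mul c).exp
  refine ((hasDerivAt_besselModEnergy ν hr).mul hexp).congr_deriv ?_
  ring

theorem antitoneOn_besselModEnergy_mul_exp (hν : -(1 / 2) < ν) :
    AntitoneOn (fun r => besselModEnergy ν r * Real.exp ((2 * ν + 1) / r)) (Ici (2 * ν + 1)) := by
  have hderiv (x : ℝ) (hx : x ∈ Ici (2 * ν + 1)) :=
    hasDerivAt_besselModEnergy_mul_exp ν (2 * ν + 1) (r := x) (by linarith [mem_Ici.1 hx])
  refine antitoneOn_of_hasDerivWithinAt_nonpos (convex_Ici _)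
    (fun x hx => (hderiv x hx).continuousAt.continuousWithinAt)
    (fun x hx => (hderiv x (interior_subset hx)).hasDerivWithinAt) fun x hx => ?_
  refine mul_nonpos_of_nonpos_of_nonneg ?_ (Real.exp_nonneg _)
  linarith [(abs_le.1 (abs_deriv_besselModEnergy_le hν (interior_subset hx))).2]

theorem monotoneOn_besselModEnergy_mul_exp (hν : -(1 / 2) < ν) :
    MonotoneOn (fun r => besselModEnergy ν r * Real.exp (-(2 * ν + 1) / r)) (Ici (2 * ν + 1)) := by
  have hderiv (x : ℝ) (hx : x ∈ Ici (2 * ν + 1)) :=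
    hasDerivAt_besselModEnergy_mul_exp ν (-(2 * ν + 1)) (r := x) (by linarith [mem_Ici.1 hx])
  refine monotoneOn_of_hasDerivWithinAt_nonneg (convex_Ici _)
    (fun x hx => (hderiv x hx).continuousAt.continuousWithinAt)
    (fun x hx => (hderiv x (interior_subset hx)).hasDerivWithinAt) fun x hx => ?_
  refine mul_nonneg ?_ (Real.exp_nonneg _)
  rw [neg_div, neg_mul]
  linarith [(abs_le.1 (abs_deriv_besselModEnergy_le hν (interior_subset hx))).1]

theorem besselEnergy_le_mul_besselEnergy (hν : -(1 / 2) < ν) (hr : 2 * ν + 1 ≤ r) (hrs : r ≤ s) :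
    besselEnergy ν s ≤ 3 * Real.exp 1 * besselEnergy ν r := by
  have hr0 : 0 < r := by linarith
  have hs : 2 * ν + 1 ≤ s := hr.trans hrs
  have hmod : 0 ≤ besselModEnergy ν s := by
    linarith [besselEnergy_nonneg ν (hr0.trans_le hrs), half_besselEnergy_le_besselModEnergy hν hs]
  calc besselEnergy ν s
      ≤ 2 * (besselModEnergy ν s * 1) := by
        linarith [half_besselEnergy_le_besselModEnergy hν hs]
    _ ≤ 2 * (besselModEnergy ν s * Real.exp ((2 * ν + 1) / s)) := by
        gcongr
        exact Real.one_le_exp (div_nonneg (by linarith) (by linarith))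
    _ ≤ 2 * (besselModEnergy ν r * Real.exp ((2 * ν + 1) / r)) := by
        gcongr 2 * ?_
        exact antitoneOn_besselModEnergy_mul_exp hν hr hs hrs
    _ ≤ 2 * (3 / 2 * besselEnergy ν r * Real.exp 1) := by
        have := besselEnergy_nonneg ν hr0
        gcongr
        · exact besselModEnergy_le hν hr
        · exact (div_le_one hr0).2 hr
    _ = _ := by ring

theorem besselEnergy_le_mul_besselEnergy_of_le (hν : -(1 / 2) < ν) (hr : 2 * ν + 1 ≤ r)
    (hrs : r ≤ s) : besselEnergy ν r ≤ 3 * Real.exp 1 * besselEnergy ν s := by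
  have hr0 : 0 < r := by linarith
  have hs : 2 * ν + 1 ≤ s := hr.trans hrs
  have henergy := besselEnergy_nonneg ν (hr0.trans_le hrs)
  have hmod : 0 ≤ besselModEnergy ν r := by
    linarith [besselEnergy_nonneg ν hr0, half_besselEnergy_le_besselModEnergy hν hr]
  calc besselEnergy ν r
      ≤ 2 * Real.exp 1 * (besselModEnergy ν r * Real.exp (-1)) := by
        rw [mul_assoc, mul_left_comm (Real.exp 1), ← Real.exp_add, add_neg_cancel, Real.exp_zero]
        linarith [half_besselEnergy_le_besselModEnergy hν hr]
    _ ≤ 2 * Real.exp 1 * (besselModEnergy ν r * Real.exp (-(2 * ν + 1) / r)) := by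
        gcongr
        rw [neg_div, neg_le_neg_iff]
        exact (div_le_one hr0).2 hr
    _ ≤ 2 * Real.exp 1 * (besselModEnergy ν s * Real.exp (-(2 * ν + 1) / s)) := by
        gcongr 2 * _ * ?_
        exact monotoneOn_besselModEnergy_mul_exp hν hr hs hrs
    _ ≤ 2 * Real.exp 1 * (3 / 2 * besselEnergy ν s * 1) := by
        gcongr
        · exact besselModEnergy_le hν hs
        · exact Real.exp_le_one_iff.2 (div_nonpos_of_nonpos_of_nonneg (by linarith) (by linarith))
    _ = _ := by ring

theorem besselEnergy_pos (hν : -(1 / 2) < ν) (hr : 0 < r) : 0 < besselEnergy ν r := by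
  -- With the weight `r ^ (2ν + 2)` the term `J_{ν+1}²` drops out of the derivative.
  have hderiv (x : ℝ) (hx : x ∈ Ioi (0 : ℝ)) :=
    hasDerivAt_rpow_mul_besselJ_sq_add ν (2 * ν + 1) (mem_Ioi.1 hx)
  have hmono : MonotoneOn
      (fun r => r ^ (2 * ν + 1 + 1) * (besselJ ν r ^ 2 + besselJ (ν + 1) r ^ 2)) (Ioi 0) := by
    refine monotoneOn_of_hasDerivWithinAt_nonneg (convex_Ioi _)
      (fun x hx => (hderiv x hx).continuousAt.continuousWithinAt)
      (fun x hx => (hderiv x (interior_subset hx)).hasDerivWithinAt) fun x hx => ?_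
    have hx0 : 0 < x := interior_subset hx
    have hcoeff : 0 ≤ 2 * ν + 1 + 1 + 2 * ν := by linarith
    rw [sub_self, zero_mul, sub_zero]
    positivity
  obtain ⟨c, hc, δ, hδ, hJ⟩ := exists_rpow_le_besselJ_sq (ν := ν) (by linarith)
  obtain ⟨x, hx0, hx⟩ := exists_between (lt_min hδ hr)
  have hJx : 0 < besselJ ν x ^ 2 :=
    lt_of_lt_of_le (by positivity) (hJ x ⟨hx0, hx.trans_le (min_le_left _ _)⟩)
  have hpos := lt_of_lt_of_le (by positivity) (hmono hx0 hr (hx.le.trans (min_le_right _ _)))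
  exact mul_pos hr (pos_of_mul_pos_right hpos (by positivity))

end BesselEnergy

section BesselMoment

variable {ν b r : ℝ}

/-- The moment `∫_0^∞ r^{1-b} J_ν(r)² dr`. -/
def besselMoment (b ν : ℝ) : ℝ≥0∞ :=
  ∫⁻ r in Ioi (0 : ℝ), ENNReal.ofReal (r ^ (1 - b) * besselJ ν r ^ 2)

theorem measurable_rpow_mul_besselJ_sq (p ν : ℝ) :
    Measurable fun r : ℝ => r ^ p * besselJ ν r ^ 2 :=
  (measurable_id.pow_const p).mul ((measurable_besselJ ν).pow_const 2)

theorem ae_nonneg_rpow_mul_besselJ_sq (p ν : ℝ) :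
    0 ≤ᵐ[volume.restrict (Ioi 0)] fun r : ℝ => r ^ p * besselJ ν r ^ 2 :=
  (ae_restrict_mem measurableSet_Ioi).mono fun _ hr =>
    mul_nonneg (Real.rpow_nonneg (mem_Ioi.1 hr).le p) (sq_nonneg _)

theorem toReal_besselMoment (b ν : ℝ) :
    (besselMoment b ν).toReal = ∫ r in Ioi (0 : ℝ), r ^ (1 - b) * besselJ ν r ^ 2 :=
  (integral_eq_lintegral_of_nonneg_ae (ae_nonneg_rpow_mul_besselJ_sq _ _)
    (measurable_rpow_mul_besselJ_sq _ _).aestronglyMeasurable).symm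

theorem besselMoment_ne_top_iff :
    besselMoment b ν ≠ ⊤ ↔
      IntegrableOn (fun r : ℝ => r ^ (1 - b) * besselJ ν r ^ 2) (Ioi 0) := by
  rw [IntegrableOn, Integrable,
    and_iff_right (measurable_rpow_mul_besselJ_sq _ _).aestronglyMeasurable,
    hasFiniteIntegral_iff_ofReal (ae_nonneg_rpow_mul_besselJ_sq _ _), lt_top_iff_ne_top,
    besselMoment]

theorem rpow_mul_besselJ_sq_add_eq (ν p : ℝ) (hr : 0 < r) :
    r ^ (p + 1) * (besselJ ν r ^ 2 + besselJ (ν + 1) r ^ 2) = r ^ p * besselEnergy ν r := by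
  rw [besselEnergy, Real.rpow_add_one hr.ne', mul_assoc]

theorem rpow_mul_besselJ_sq_le (hν : -(1 / 2) < ν) (p : ℝ) (hr : 2 * ν + 1 ≤ r) :
    r ^ (p + 1) * besselJ ν r ^ 2 ≤
      3 * Real.exp 1 * besselEnergy ν (2 * ν + 1) * r ^ p := by
  have hr0 : 0 < r := by linarith
  calc r ^ (p + 1) * besselJ ν r ^ 2
      ≤ r ^ (p + 1) * (besselJ ν r ^ 2 + besselJ (ν + 1) r ^ 2) := by
        gcongr
        exact le_add_of_nonneg_right (sq_nonneg _)
    _ = besselEnergy ν r * r ^ p := by rw [rpow_mul_besselJ_sq_add_eq ν p hr0, mul_comm]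
    _ ≤ _ := by
        gcongr
        exact besselEnergy_le_mul_besselEnergy hν le_rfl hr

theorem besselMoment_ne_top (hν : -(1 / 2) < ν) (hb : 1 < b) (hbν : b < 2 * ν + 2) :
    besselMoment b ν ≠ ⊤ := by
  have hκ : 0 < 2 * ν + 1 := by linarith
  rw [besselMoment_ne_top_iff, ← Ioc_union_Ioi_eq_Ioi hκ.le]
  refine IntegrableOn.union ?_ ?_
  · refine IntegrableOn.congr_fun (f := fun r : ℝ =>
      r ^ (1 - b + 2 * ν) * ((1 / 2) ^ ν * besselSeries ν (-(r ^ 2 / 4))) ^ 2) ?_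
      (fun r hr => (rpow_mul_besselJ_sq _ hr.1).symm) measurableSet_Ioc
    rw [← integrableOn_Icc_iff_integrableOn_Ioc]
    refine IntegrableOn.mul_continuousOn ?_
      (continuous_half_rpow_mul_besselSeries ν).continuousOn isCompact_Icc
    rw [integrableOn_Icc_iff_integrableOn_Ioc,
      ← intervalIntegrable_iff_integrableOn_Ioc_of_le hκ.le]
    exact intervalIntegral.intervalIntegrable_rpow' (by linarith)
  · refine ((integrableOn_Ioi_rpow_of_lt (neg_lt_neg hb) hκ).const_mul
      (3 * Real.exp 1 * besselEnergy ν (2 * ν + 1))).mono'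
      (measurable_rpow_mul_besselJ_sq _ ν).aestronglyMeasurable ?_
    filter_upwards [ae_restrict_mem measurableSet_Ioi] with r hr
    have hr0 : 0 < r := hκ.trans hr
    rw [Real.norm_of_nonneg (by positivity), sub_eq_neg_add]
    exact rpow_mul_besselJ_sq_le hν (-b) hr.le

theorem tendsto_rpow_mul_besselJ_sq_nhdsGT_zero {p : ℝ} (hp : 0 < p + 2 * ν) :
    Tendsto (fun r : ℝ => r ^ p * besselJ ν r ^ 2) (𝓝[>] 0) (𝓝 0) := by
  have hlim := ((Real.continuousAt_rpow_const 0 _ (Or.inr hp.le)).tendsto.mul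
    (continuous_half_rpow_mul_besselSeries ν).continuousAt.tendsto).mono_left
      (nhdsWithin_le_nhds (s := Ioi 0))
  rw [Real.zero_rpow hp.ne', zero_mul] at hlim
  refine hlim.congr' ?_
  filter_upwards [self_mem_nhdsWithin] with r hr
  exact (rpow_mul_besselJ_sq p hr).symm

theorem tendsto_rpow_mul_besselEnergy_atTop (hν : -(1 / 2) < ν) {p : ℝ} (hp : p < 0) :
    Tendsto (fun r : ℝ => r ^ p * besselEnergy ν r) atTop (𝓝 0) := by
  have hbound := (tendsto_rpow_neg_atTop (neg_pos.2 hp)).mul_const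
    (3 * Real.exp 1 * besselEnergy ν (2 * ν + 1))
  rw [neg_neg, zero_mul] at hbound
  refine squeeze_zero' ?_ ?_ hbound
  · filter_upwards [eventually_gt_atTop 0] with r hr
    exact mul_nonneg (by positivity) (besselEnergy_nonneg ν hr)
  · filter_upwards [eventually_ge_atTop (2 * ν + 1)] with r hr
    have hr0 : 0 < r := by linarith
    gcongr
    exact besselEnergy_le_mul_besselEnergy hν le_rfl hr

theorem besselMoment_add_one (hν : -(1 / 2) < ν) (hb : 1 < b) (hbν : b < 2 * ν + 2) :
    (besselMoment b (ν + 1)).toReal * (2 * ν + b) =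
      (besselMoment b ν).toReal * (2 * ν + 2 - b) := by
  have hint := besselMoment_ne_top_iff.1 (besselMoment_ne_top hν hb hbν)
  have hint' := besselMoment_ne_top_iff.1
    (besselMoment_ne_top (ν := ν + 1) (by linarith) hb (by linarith))
  have hderiv (r : ℝ) (hr : r ∈ Ioi (0 : ℝ)) : HasDerivAt
      (fun r => r ^ (1 - b + 1) * (besselJ ν r ^ 2 + besselJ (ν + 1) r ^ 2))
      ((2 * ν + 2 - b) * (r ^ (1 - b) * besselJ ν r ^ 2) -
        (2 * ν + b) * (r ^ (1 - b) * besselJ (ν + 1) r ^ 2)) r :=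
    (hasDerivAt_rpow_mul_besselJ_sq_add ν (1 - b) hr).congr_deriv (by ring)
  have hzero : Tendsto
      (fun r => r ^ (1 - b + 1) * (besselJ ν r ^ 2 + besselJ (ν + 1) r ^ 2)) (𝓝[>] 0) (𝓝 0) := by
    simpa only [mul_add, add_zero] using
      (tendsto_rpow_mul_besselJ_sq_nhdsGT_zero (ν := ν) (p := 1 - b + 1) (by linarith)).add
        (tendsto_rpow_mul_besselJ_sq_nhdsGT_zero (ν := ν + 1) (by linarith))
  have htop : Tendsto
      (fun r => r ^ (1 - b + 1) * (besselJ ν r ^ 2 + besselJ (ν + 1) r ^ 2)) atTop (𝓝 0) :=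
    (tendsto_rpow_mul_besselEnergy_atTop hν (p := 1 - b) (by linarith)).congr' <|
      (eventually_gt_atTop 0).mono fun r hr => (rpow_mul_besselJ_sq_add_eq ν _ hr).symm
  have hparts := integral_Ioi_deriv_mul_eq_sub (u := fun _ => (1 : ℝ)) (u' := fun _ => 0)
    (fun r _ => hasDerivAt_const r 1) hderiv
    (by simpa [IntegrableOn, Pi.mul_def, Pi.add_def, Pi.sub_def] using
      (hint.const_mul (2 * ν + 2 - b)).sub (hint'.const_mul (2 * ν + b)))
    (by simpa [Pi.mul_def] using hzero) (by simpa [Pi.mul_def] using htop)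
  simp only [zero_mul, zero_add, one_mul, sub_zero] at hparts
  rw [integral_sub (hint.const_mul _) (hint'.const_mul _), integral_const_mul,
    integral_const_mul] at hparts
  rw [toReal_besselMoment, toReal_besselMoment]
  linear_combination -hparts

theorem lt_of_besselMoment_ne_top (hν : -1 < ν) (h : besselMoment b ν ≠ ⊤) :
    b < 2 * ν + 2 := by
  obtain ⟨c, hc, δ, hδ, hJ⟩ := exists_rpow_le_besselJ_sq hν
  have hpow : IntegrableOn (fun r : ℝ => r ^ (1 - b + 2 * ν)) (Ioo 0 δ) := by
    refine (((besselMoment_ne_top_iff.1 h).mono_set Ioo_subset_Ioi_self).const_mul c⁻¹).mono'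
      (measurable_id.pow_const _).aestronglyMeasurable ?_
    filter_upwards [ae_restrict_mem measurableSet_Ioo] with r hr
    have hr0 : 0 < r := hr.1
    rw [Real.norm_of_nonneg (by positivity), le_inv_mul_iff₀ hc, Real.rpow_add hr0,
      mul_left_comm]
    gcongr
    exact hJ r hr
  linarith [(intervalIntegral.integrableOn_Ioo_rpow_iff hδ).1 hpow]

theorem one_lt_of_besselMoment_ne_top (hν : -(1 / 2) < ν) (h : besselMoment b ν ≠ ⊤)
    (h' : besselMoment b (ν + 1) ≠ ⊤) : 1 < b := by
  have hκ : 0 < 2 * ν + 1 := by linarith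
  set c : ℝ := besselEnergy ν (2 * ν + 1)
  have hc : 0 < c := besselEnergy_pos hν hκ
  have hint := (besselMoment_ne_top_iff.1 h).add (besselMoment_ne_top_iff.1 h')
  have hpow : IntegrableOn (fun r : ℝ => r ^ (-b)) (Ioi (2 * ν + 1)) := by
    refine ((hint.mono_set (Ioi_subset_Ioi hκ.le)).const_mul (3 * Real.exp 1 / c)).mono'
      (measurable_id.pow_const _).aestronglyMeasurable ?_
    filter_upwards [ae_restrict_mem measurableSet_Ioi] with r hr
    have hr0 : 0 < r := hκ.trans hr
    rw [Real.norm_of_nonneg (by positivity), Pi.add_apply, ← mul_add, sub_eq_neg_add,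
      rpow_mul_besselJ_sq_add_eq ν (-b) hr0, div_mul_eq_mul_div, le_div_iff₀ hc, mul_left_comm]
    gcongr
    exact besselEnergy_le_mul_besselEnergy_of_le hν le_rfl hr.le
  linarith [(integrableOn_Ioi_rpow_iff hκ).1 hpow]

theorem besselMoment_pos (hν : -1 < ν) (b : ℝ) : 0 < besselMoment b ν := by
  obtain ⟨c, hc, δ, hδ, hJ⟩ := exists_rpow_le_besselJ_sq hν
  rw [besselMoment, setLIntegral_pos_iff (measurable_rpow_mul_besselJ_sq _ ν).ennreal_ofReal]
  refine lt_of_lt_of_le (b := volume (Ioo 0 δ)) (by simpa using hδ) (measure_mono fun r hr => ?_)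
  have hr0 : 0 < r := hr.1
  have hJr : 0 < besselJ ν r ^ 2 := lt_of_lt_of_le (by positivity) (hJ r hr)
  exact ⟨(ENNReal.ofReal_pos.2 (by positivity)).ne', hr0⟩

end BesselMoment

section MomentAsymptotics

theorem exists_bounds_of_tendsto_pos {X : ℕ → ℝ} {L : ℝ} (hX : ∀ k, 0 < X k) (hL : 0 < L)
    (h : Tendsto X atTop (𝓝 L)) : ∃ c > 0, ∃ C > 0, ∀ k, c ≤ X k ∧ X k ≤ C := by
  obtain ⟨C, hC⟩ := h.bddAbove_range
  obtain ⟨D, hD⟩ := (h.inv₀ hL.ne').bddAbove_range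
  have hXC (k : ℕ) : X k ≤ C := hC (mem_range_self k)
  have hXD (k : ℕ) : (X k)⁻¹ ≤ D := hD (mem_range_self k)
  have hD0 : 0 < D := (inv_pos.2 (hX 0)).trans_le (hXD 0)
  exact ⟨D⁻¹, inv_pos.2 hD0, C, (hX 0).trans_le (hXC 0),
    fun k => ⟨inv_le_of_inv_le₀ (hX k) (hXD k), hXC k⟩⟩

theorem prod_range_add_eq_div_GammaSeq {s : ℝ} {k : ℕ} (hk : 0 < k) :
    ∏ j ∈ Finset.range (k + 1), (s + j) = (k : ℝ) ^ s * k.factorial / Real.GammaSeq s k := by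
  have hnum : (0 : ℝ) < (k : ℝ) ^ s * k.factorial := by positivity
  rw [Real.GammaSeq, div_div_cancel₀ hnum.ne']

theorem GammaSeq_pos {s : ℝ} (hs : 0 < s) {k : ℕ} (hk : 0 < k) : 0 < Real.GammaSeq s k := by
  have : 0 < ∏ j ∈ Finset.range (k + 1), (s + j) := Finset.prod_pos fun j _ => by positivity
  rw [Real.GammaSeq]
  positivity

section Recurrence

variable {A : ℕ → ℝ} {α β : ℝ}

theorem mul_prod_eq_mul_prod_of_recurrence
    (hA : ∀ k, A (k + 1) * (β + k) = A k * (α + k)) (k : ℕ) :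
    A k * ∏ j ∈ Finset.range k, (β + j) = A 0 * ∏ j ∈ Finset.range k, (α + j) := by
  induction k with
  | zero => simp
  | succ k ih =>
    rw [Finset.prod_range_succ, Finset.prod_range_succ]
    linear_combination (∏ j ∈ Finset.range k, (β + (j : ℝ))) * hA k + (α + k) * ih

theorem tendsto_rpow_mul_of_recurrence (hα : 0 < α) (hβ : 0 < β)
    (hA : ∀ k, A (k + 1) * (β + k) = A k * (α + k)) :
    Tendsto (fun k : ℕ => (k : ℝ) ^ (β - α) * A (k + 1)) atTop
      (𝓝 (A 0 * (Real.Gamma β / Real.Gamma α))) := by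
  refine (((Real.GammaSeq_tendsto_Gamma β).div (Real.GammaSeq_tendsto_Gamma α)
    (Real.Gamma_pos_of_pos hα).ne').const_mul (A 0)).congr' ?_
  filter_upwards [eventually_gt_atTop 0] with k hk
  have hprod := mul_prod_eq_mul_prod_of_recurrence hA (k + 1)
  rw [prod_range_add_eq_div_GammaSeq hk, prod_range_add_eq_div_GammaSeq hk] at hprod
  have hGα := (GammaSeq_pos hα hk).ne'
  have hGβ := (GammaSeq_pos hβ hk).ne'
  have hkα : (k : ℝ) ^ α ≠ 0 := by positivity
  have hfact : (k.factorial : ℝ) ≠ 0 := by positivity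
  rw [Pi.div_apply, Real.rpow_sub (by positivity)]
  field_simp at hprod ⊢
  linear_combination -hprod

end Recurrence

/-- The eigenvalue `k (k + n - 2)` of `-Δ_ω` on the spherical harmonics of degree `k`. -/
def eigval (n k : ℕ) : ℝ := k * (k + n - 2)

theorem eigval_nonneg {n : ℕ} (hn : 2 ≤ n) (k : ℕ) : 0 ≤ eigval n k := by
  have hn' : (2 : ℝ) ≤ n := by exact_mod_cast hn
  exact mul_nonneg k.cast_nonneg (by linarith [(k.cast_nonneg : (0 : ℝ) ≤ k)])

theorem eigval_injective {n : ℕ} (hn : 2 ≤ n) : Function.Injective (eigval n) := by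
  have hn' : (2 : ℝ) ≤ n := by exact_mod_cast hn
  refine (strictMono_nat_of_lt_succ fun k => ?_).injective
  have : (0 : ℝ) ≤ k := k.cast_nonneg
  simp only [eigval]
  push_cast
  nlinarith

theorem tendsto_one_add_eigval_div_sq (n : ℕ) :
    Tendsto (fun k : ℕ => (1 + eigval n (k + 1)) / (k : ℝ) ^ 2) atTop (𝓝 1) := by
  have hinv : Tendsto (fun k : ℕ => (k : ℝ)⁻¹) atTop (𝓝 0) := tendsto_inv_atTop_nhds_zero_nat
  have hlim : Tendsto (fun k : ℕ => (k : ℝ)⁻¹ ^ 2 + (1 + (k : ℝ)⁻¹) *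
      (1 + ((n : ℝ) - 1) * (k : ℝ)⁻¹)) atTop (𝓝 (0 ^ 2 + (1 + 0) * (1 + ((n : ℝ) - 1) * 0))) :=
    (hinv.pow 2).add ((hinv.const_add 1).mul ((hinv.const_mul _).const_add 1))
  rw [show (0 : ℝ) ^ 2 + (1 + 0) * (1 + ((n : ℝ) - 1) * 0) = 1 by ring] at hlim
  refine hlim.congr' ?_
  filter_upwards [eventually_gt_atTop 0] with k hk
  have : (k : ℝ) ≠ 0 := by positivity
  simp only [eigval]
  push_cast
  field_simp
  ring

section

variable {n : ℕ} {b : ℝ}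

/-- The order `k + n/2 - 1` of the Bessel function in the Fourier transform of a spherical harmonic
of degree `k`. -/
def besselOrder (n k : ℕ) : ℝ := n / 2 - 1 + k

theorem besselOrder_nonneg (hn : 2 ≤ n) (k : ℕ) : 0 ≤ besselOrder n k := by
  have hn' : (2 : ℝ) ≤ n := by exact_mod_cast hn
  exact add_nonneg (by linarith) k.cast_nonneg

theorem besselOrder_succ (n k : ℕ) : besselOrder n (k + 1) = besselOrder n k + 1 := by
  rw [besselOrder, besselOrder, Nat.cast_add_one, add_assoc]

theorem besselMoment_besselOrder_ne_top (hn : 2 ≤ n) (hb : 1 < b) (hbn : b < n) (k : ℕ) :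
    besselMoment b (besselOrder n k) ≠ ⊤ := by
  refine besselMoment_ne_top (by linarith [besselOrder_nonneg hn k]) hb ?_
  rw [besselOrder]
  linarith [(k.cast_nonneg : (0 : ℝ) ≤ k)]

theorem besselMoment_besselOrder_succ (hn : 2 ≤ n) (hb : 1 < b) (hbn : b < n) (k : ℕ) :
    (besselMoment b (besselOrder n (k + 1))).toReal * ((n + b) / 2 - 1 + k) =
      (besselMoment b (besselOrder n k)).toReal * ((n - b) / 2 + k) := by
  have : (0 : ℝ) ≤ k := k.cast_nonneg
  have hrec := besselMoment_add_one (ν := besselOrder n k) (by linarith [besselOrder_nonneg hn k])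
    hb (by rw [besselOrder]; linarith)
  rw [← besselOrder_succ] at hrec
  simp only [besselOrder] at hrec ⊢
  linear_combination hrec / 2

theorem tendsto_rpow_mul_besselMoment (hn : 2 ≤ n) (hb : 1 < b) (hbn : b < n) :
    Tendsto (fun k : ℕ =>
        (1 + eigval n k) ^ ((b - 1) / 2) * (besselMoment b (besselOrder n k)).toReal) atTop
      (𝓝 ((besselMoment b (besselOrder n 0)).toReal *
        (Real.Gamma ((n + b) / 2 - 1) / Real.Gamma ((n - b) / 2)))) := by
  have : (2 : ℝ) ≤ n := by exact_mod_cast hn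
  have hmoment := tendsto_rpow_mul_of_recurrence
    (A := fun k => (besselMoment b (besselOrder n k)).toReal) (by linarith) (by linarith)
    (besselMoment_besselOrder_succ hn hb hbn)
  have heigval := (tendsto_one_add_eigval_div_sq n).rpow_const (p := (b - 1) / 2)
    (Or.inl one_ne_zero)
  rw [Real.one_rpow] at heigval
  rw [← tendsto_add_atTop_iff_nat 1, ← one_mul (_ * _)]
  refine (heigval.mul hmoment).congr' ?_
  filter_upwards [eventually_gt_atTop 0] with k hk
  have hk0 : (0 : ℝ) < k := by positivity
  have hpow : ((k : ℝ) ^ 2) ^ ((b - 1) / 2) = (k : ℝ) ^ ((n + b) / 2 - 1 - (n - b) / 2) := by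
    rw [← Real.rpow_natCast, ← Real.rpow_mul hk0.le]
    congr 1
    push_cast
    ring
  rw [Real.div_rpow (by linarith [eigval_nonneg hn (k + 1)]) (by positivity), hpow, ← mul_assoc,
    div_mul_cancel₀ _ (by positivity)]

theorem exists_besselMoment_bounds (hn : 2 ≤ n) (hb : 1 < b) (hbn : b < n) :
    ∃ c > 0, ∃ C > 0, ∀ k,
      ENNReal.ofReal c ≤
        ENNReal.ofReal ((1 + eigval n k) ^ ((b - 1) / 2)) * besselMoment b (besselOrder n k) ∧
      ENNReal.ofReal ((1 + eigval n k) ^ ((b - 1) / 2)) * besselMoment b (besselOrder n k) ≤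
        ENNReal.ofReal C := by
  have : (2 : ℝ) ≤ n := by exact_mod_cast hn
  have hfin := besselMoment_besselOrder_ne_top hn hb hbn
  have hweight (k : ℕ) : 0 < (1 + eigval n k) ^ ((b - 1) / 2) := by
    have := eigval_nonneg hn k
    positivity
  have hpos (k : ℕ) : 0 < (besselMoment b (besselOrder n k)).toReal :=
    ENNReal.toReal_pos (besselMoment_pos (by linarith [besselOrder_nonneg hn k]) b).ne' (hfin k)
  obtain ⟨c, hc, C, hC, h⟩ := exists_bounds_of_tendsto_pos
    (fun k => mul_pos (hweight k) (hpos k)) (mul_pos (hpos 0) (div_pos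
      (Real.Gamma_pos_of_pos (by linarith)) (Real.Gamma_pos_of_pos (by linarith))))
    (tendsto_rpow_mul_besselMoment hn hb hbn)
  have hofReal (k : ℕ) : ENNReal.ofReal ((1 + eigval n k) ^ ((b - 1) / 2) *
      (besselMoment b (besselOrder n k)).toReal) =
      ENNReal.ofReal ((1 + eigval n k) ^ ((b - 1) / 2)) * besselMoment b (besselOrder n k) := by
    rw [ENNReal.ofReal_mul (hweight k).le, ENNReal.ofReal_toReal (hfin k)]
  exact ⟨c, hc, C, hC, fun k => hofReal k ▸
    ⟨ENNReal.ofReal_le_ofReal (h k).1, ENNReal.ofReal_le_ofReal (h k).2⟩⟩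

end

end MomentAsymptotics

section SolidHarmonics

open MvPolynomial

variable {σ R : Type*} [CommRing R] {k : ℕ} {p : MvPolynomial σ R}

theorem pderiv_pderiv_comm (i j : σ) (p : MvPolynomial σ R) :
    pderiv i (pderiv j p) = pderiv j (pderiv i p) := by
  have h : ⁅(pderiv i : Derivation R (MvPolynomial σ R) (MvPolynomial σ R)),
      (pderiv j : Derivation R (MvPolynomial σ R) (MvPolynomial σ R))⁆ = 0 := by
    classical
    refine MvPolynomial.derivation_ext fun l => ?_
    rw [Derivation.commutator_apply, pderiv_X, pderiv_X]
    by_cases hj : l = j <;> by_cases hi : l = i <;> simp [Pi.single_apply, hi, hj, apply_ite]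
  rw [← sub_eq_zero, ← Derivation.commutator_apply, h, Derivation.coe_zero, Pi.zero_apply]

theorem pderiv_eq_zero_of_isHomogeneous_zero (hp : p.IsHomogeneous 0) (i : σ) :
    pderiv i p = 0 := by
  rw [totalDegree_eq_zero_iff_eq_C.1 (Nat.le_zero.1 hp.totalDegree_le), pderiv_C]

/-- The rotation field `x_i ∂_j - x_j ∂_i` as a derivation on polynomials. -/
def polyRot (i j : σ) : Derivation R (MvPolynomial σ R) (MvPolynomial σ R) :=
  (X i : MvPolynomial σ R) • pderiv j - (X j : MvPolynomial σ R) • pderiv i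

theorem polyRot_apply (i j : σ) (p : MvPolynomial σ R) :
    polyRot i j p = X i * pderiv j p - X j * pderiv i p := rfl

theorem polyRot_self (i : σ) (p : MvPolynomial σ R) : polyRot i i p = 0 := by
  rw [polyRot_apply, sub_self]

theorem polyRot_polyRot_swap (i j : σ) (p : MvPolynomial σ R) :
    polyRot i j (polyRot i j p) = polyRot j i (polyRot j i p) := by
  have hswap (q : MvPolynomial σ R) : polyRot i j q = -polyRot j i q := by
    rw [polyRot_apply, polyRot_apply, neg_sub]
  rw [hswap p, map_neg, hswap, neg_neg]

theorem polyRot_polyRot [DecidableEq σ] (i j : σ) (p : MvPolynomial σ R) :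
    polyRot i j (polyRot i j p) =
      (X i ^ 2 * pderiv j (pderiv j p) - X i * pderiv i p -
        X i * (X j * pderiv j (pderiv i p))) +
      (X j ^ 2 * pderiv i (pderiv i p) - X j * pderiv j p -
        X j * (X i * pderiv i (pderiv j p))) +
      if i = j then 2 * (X i * pderiv i p) else 0 := by
  simp only [polyRot_apply, map_sub, Derivation.leibniz, smul_eq_mul, pderiv_X]
  by_cases hij : i = j
  · subst hij
    simp only [Pi.single_eq_same, if_true]
    ring
  · simp only [Pi.single_eq_of_ne hij, Pi.single_eq_of_ne (Ne.symm hij), Pi.single_eq_same,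
      if_neg hij]
    ring

variable [Fintype σ]

/-- The Laplacian `∑ ∂_i²` on polynomials. -/
def polyLaplacian : MvPolynomial σ R →ₗ[R] MvPolynomial σ R :=
  ∑ i, (pderiv i).toLinearMap ∘ₗ (pderiv i).toLinearMap

/-- The polynomial `|x|²`. -/
def polyNormSq : MvPolynomial σ R := ∑ i, X i ^ 2

theorem polyLaplacian_apply (p : MvPolynomial σ R) :
    polyLaplacian p = ∑ i, pderiv i (pderiv i p) := by
  simp [polyLaplacian]

theorem polyLaplacian_pderiv (i : σ) (p : MvPolynomial σ R) :
    polyLaplacian (pderiv i p) = pderiv i (polyLaplacian p) := by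
  simp only [polyLaplacian_apply, map_sum]
  refine Finset.sum_congr rfl fun j _ => ?_
  rw [pderiv_pderiv_comm j i, pderiv_pderiv_comm j i]

theorem polyLaplacian_mul (p q : MvPolynomial σ R) :
    polyLaplacian (p * q) =
      p * polyLaplacian q + 2 * ∑ i, pderiv i p * pderiv i q + q * polyLaplacian p := by
  simp only [polyLaplacian_apply, Finset.mul_sum, ← Finset.sum_add_distrib, Derivation.leibniz,
    map_add, smul_eq_mul]
  exact Finset.sum_congr rfl fun i _ => by ring

theorem polyLaplacian_X_mul (i : σ) (p : MvPolynomial σ R) :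
    polyLaplacian (X i * p) = X i * polyLaplacian p + 2 * pderiv i p := by
  classical
  have hX : polyLaplacian (X i : MvPolynomial σ R) = 0 := by
    rw [polyLaplacian_apply]
    refine Finset.sum_eq_zero fun j _ => ?_
    by_cases h : j = i <;> simp [pderiv_X, h]
  have hgrad : ∑ j, pderiv j (X i : MvPolynomial σ R) * pderiv j p = pderiv i p := by
    simp [pderiv_X, Pi.single_apply]
  rw [polyLaplacian_mul, hX, hgrad, mul_zero, add_zero]

theorem pderiv_polyNormSq (i : σ) : pderiv i (polyNormSq : MvPolynomial σ R) = 2 * X i := by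
  classical
  simp [polyNormSq, Derivation.leibniz_pow, pderiv_X, Pi.single_apply]

theorem polyLaplacian_polyNormSq :
    polyLaplacian (polyNormSq : MvPolynomial σ R) = C (2 * Fintype.card σ : R) := by
  have h (i : σ) : pderiv i (2 * X i : MvPolynomial σ R) = 2 := by
    rw [two_mul, map_add, pderiv_X_self, one_add_one_eq_two]
  simp only [polyLaplacian_apply, pderiv_polyNormSq, h]
  simp [mul_comm, map_ofNat C 2]

theorem polyLaplacian_polyNormSq_mul (p : MvPolynomial σ R) :
    polyLaplacian (polyNormSq * p) =
      polyNormSq * polyLaplacian p + 4 * ∑ i, X i * pderiv i p +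
        C (2 * Fintype.card σ : R) * p := by
  simp only [polyLaplacian_mul, pderiv_polyNormSq, polyLaplacian_polyNormSq, mul_assoc,
    ← Finset.mul_sum]
  ring

theorem isHomogeneous_polyNormSq : (polyNormSq : MvPolynomial σ R).IsHomogeneous 2 :=
  IsHomogeneous.sum _ _ _ fun i _ => isHomogeneous_X_pow i 2

theorem sum_X_mul_pderiv_of_isHomogeneous (hp : p.IsHomogeneous k) :
    ∑ i, X i * pderiv i p = C (k : R) * p := by
  rw [hp.sum_X_mul_pderiv, nsmul_eq_mul, map_natCast]

theorem sum_X_mul_pderiv_pderiv_of_isHomogeneous (hp : p.IsHomogeneous k) (i : σ) :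
    ∑ j, X j * pderiv j (pderiv i p) = C ((k : R) - 1) * pderiv i p := by
  rcases k with _ | k
  · simp [pderiv_eq_zero_of_isHomogeneous_zero hp i]
  · rw [sum_X_mul_pderiv_of_isHomogeneous hp.pderiv]
    simp

theorem sum_polyRot_polyRot_of_isHomogeneous (hp : p.IsHomogeneous k) :
    ∑ i, ∑ j, polyRot i j (polyRot i j p) =
      2 * (polyNormSq * polyLaplacian p - C (k * (k + Fintype.card σ - 2) : R) * p) := by
  classical
  have heuler := sum_X_mul_pderiv_of_isHomogeneous hp
  have hhalf : ∑ i, ∑ j, (X i ^ 2 * pderiv j (pderiv j p) - X i * pderiv i p -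
      X i * (X j * pderiv j (pderiv i p))) =
      polyNormSq * polyLaplacian p - C (k * (k + Fintype.card σ - 1) : R) * p := by
    have hscale (c : MvPolynomial σ R) :
        ∑ i, X i * (c * pderiv i p) = c * (C (k : R) * p) := by
      simp only [← heuler, Finset.mul_sum, mul_left_comm]
    simp only [Finset.sum_sub_distrib, ← Finset.mul_sum, ← Finset.sum_mul, ← polyLaplacian_apply,
      sum_X_mul_pderiv_pderiv_of_isHomogeneous hp, hscale, Finset.sum_const,
      Finset.card_univ, nsmul_eq_mul, polyNormSq]
    simp only [map_mul, map_add, map_sub, map_natCast, map_one]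
    ring
  have hhalf' := hhalf
  rw [Finset.sum_comm] at hhalf'
  simp only [polyRot_polyRot, Finset.sum_add_distrib, hhalf, hhalf', Finset.sum_ite_eq,
    Finset.mem_univ, if_true, ← Finset.mul_sum, heuler]
  simp only [map_mul, map_add, map_sub, map_natCast, map_one, map_ofNat]
  ring

variable (σ R k) in
/-- The solid spherical harmonics of degree `k`: the harmonic homogeneous polynomials. -/
def solidHarmonics : Submodule R (MvPolynomial σ R) :=
  homogeneousSubmodule σ R k ⊓ LinearMap.ker polyLaplacian

theorem mem_solidHarmonics :
    p ∈ solidHarmonics σ R k ↔ p.IsHomogeneous k ∧ polyLaplacian p = 0 := Iff.rfl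

theorem C_mem_solidHarmonics (a : R) : (C a : MvPolynomial σ R) ∈ solidHarmonics σ R 0 :=
  ⟨isHomogeneous_C σ a, by simp [polyLaplacian_apply]⟩

theorem X_mem_solidHarmonics (i : σ) : (X i : MvPolynomial σ R) ∈ solidHarmonics σ R 1 := by
  classical
  refine mem_solidHarmonics.2 ⟨isHomogeneous_X R i, ?_⟩
  rw [polyLaplacian_apply]
  refine Finset.sum_eq_zero fun j _ => ?_
  rw [pderiv_X, Pi.single_apply]
  split_ifs <;> simp

theorem pderiv_mem_solidHarmonics (hp : p ∈ solidHarmonics σ R k) (i : σ) :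
    pderiv i p ∈ solidHarmonics σ R (k - 1) :=
  ⟨(mem_solidHarmonics.1 hp).1.pderiv, by
    change polyLaplacian (pderiv i p) = 0
    rw [polyLaplacian_pderiv, (mem_solidHarmonics.1 hp).2, map_zero]⟩

end SolidHarmonics

section Raising

open MvPolynomial

variable {σ K : Type*} [Fintype σ] [Field K] {k : ℕ} {p : MvPolynomial σ K}

/-- The component of degree `k + 1` of `x_i p`, for `p` a solid harmonic of degree `k`; the other
component is a multiple of `∂_i p`. -/
def raiseHarmonic (k : ℕ) (i : σ) (p : MvPolynomial σ K) : MvPolynomial σ K :=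
  X i * p - C (2 * k + Fintype.card σ - 2 : K)⁻¹ * (polyNormSq * pderiv i p)

variable [CharZero K]

theorem two_mul_add_card_sub_two_ne_zero [Nonempty σ] (k : ℕ) :
    (2 * (k + 1 : ℕ) + Fintype.card σ - 2 : K) ≠ 0 := by
  have hcard : (2 * k + Fintype.card σ : ℕ) ≠ 0 := by positivity
  rw [show (2 * (k + 1 : ℕ) + Fintype.card σ - 2 : K) = (2 * k + Fintype.card σ : ℕ) by
    push_cast; ring]
  exact_mod_cast hcard

theorem polyLaplacian_raiseHarmonic (hp : p ∈ solidHarmonics σ K k) (i : σ) :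
    polyLaplacian (raiseHarmonic k i p) = 0 := by
  obtain ⟨hhom, hharm⟩ := mem_solidHarmonics.1 hp
  have : Nonempty σ := ⟨i⟩
  rw [raiseHarmonic, map_sub, polyLaplacian_X_mul, ← smul_eq_C_mul, map_smul,
    polyLaplacian_polyNormSq_mul, sum_X_mul_pderiv_pderiv_of_isHomogeneous hhom,
    (pderiv_mem_solidHarmonics hp i).2, hharm, smul_eq_C_mul]
  rcases k with _ | k
  · simp [pderiv_eq_zero_of_isHomogeneous_zero hhom]
  · have hinv : (C (2 * (k + 1 : ℕ) + Fintype.card σ - 2 : K)⁻¹ : MvPolynomial σ K) *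
        C (2 * (k + 1 : ℕ) + Fintype.card σ - 2 : K) = 1 := by
      rw [← C_mul, inv_mul_cancel₀ (two_mul_add_card_sub_two_ne_zero k), C_1]
    simp only [map_add, map_sub, map_mul, map_natCast, map_ofNat, map_one] at hinv ⊢
    linear_combination (-2 * pderiv i p) * hinv

theorem raiseHarmonic_mem (hp : p ∈ solidHarmonics σ K k) (i : σ) :
    raiseHarmonic k i p ∈ solidHarmonics σ K (k + 1) := by
  refine ⟨?_, polyLaplacian_raiseHarmonic hp i⟩
  have hhom := (mem_solidHarmonics.1 hp).1
  refine ((add_comm 1 k) ▸ (isHomogeneous_X K i).mul hhom).sub ?_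
  rcases k with _ | k
  · rw [pderiv_eq_zero_of_isHomogeneous_zero hhom, mul_zero, mul_zero]
    exact isHomogeneous_zero _ _ _
  · have h := (isHomogeneous_polyNormSq.mul (hhom.pderiv (i := i))).C_mul
      (2 * ((k + 1 : ℕ) : K) + Fintype.card σ - 2)⁻¹
    rwa [show 2 + (k + 1 - 1) = k + 1 + 1 by lia] at h

theorem exists_mem_iSup_solidHarmonics (p : MvPolynomial σ K) :
    ∃ q ∈ ⨆ k, solidHarmonics σ K k, ∀ x, eval x polyNormSq = 1 → eval x p = eval x q := by
  induction p using MvPolynomial.induction_on with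
  | C a => exact ⟨C a, Submodule.mem_iSup_of_mem 0 (C_mem_solidHarmonics a), fun _ _ => rfl⟩
  | add p q hp hq =>
    obtain ⟨p', hp', hp⟩ := hp
    obtain ⟨q', hq', hq⟩ := hq
    exact ⟨p' + q', add_mem hp' hq', fun x hx => by rw [map_add, map_add, hp x hx, hq x hx]⟩
  | mul_X p i hp =>
    obtain ⟨p', hp', hp⟩ := hp
    suffices h : ∃ q ∈ ⨆ k, solidHarmonics σ K k,
        ∀ x, eval x polyNormSq = 1 → eval x p' * x i = eval x q by
      obtain ⟨q, hq, h⟩ := h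
      exact ⟨q, hq, fun x hx => by rw [map_mul, eval_X, hp x hx, h x hx]⟩
    clear hp
    induction hp' using Submodule.iSup_induction' with
    | mem k q hq =>
      refine ⟨raiseHarmonic k i q + (2 * k + Fintype.card σ - 2 : K)⁻¹ • pderiv i q,
        add_mem (Submodule.mem_iSup_of_mem _ (raiseHarmonic_mem hq i)) (Submodule.smul_mem _ _
          (Submodule.mem_iSup_of_mem _ (pderiv_mem_solidHarmonics hq i))), fun x hx => ?_⟩
      simp only [raiseHarmonic, map_add, map_sub, map_mul, eval_X, eval_C, hx, smul_eval]
      ring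
    | zero => exact ⟨0, zero_mem _, fun x _ => by simp⟩
    | add a b _ _ ha hb =>
      obtain ⟨a', ha', ha⟩ := ha
      obtain ⟨b', hb', hb⟩ := hb
      exact ⟨a' + b', add_mem ha' hb', fun x hx => by
        rw [map_add, map_add, add_mul, ha x hx, hb x hx]⟩

end Raising

section PolyFun

open MvPolynomial

theorem sum_sum_eq_two_nsmul_sum_sum_lt {ι M : Type*} [Fintype ι] [LinearOrder ι]
    [AddCommMonoid M] {S : ι → ι → M} (hsymm : ∀ i j, S i j = S j i) (hdiag : ∀ i, S i i = 0) :
    ∑ i, ∑ j, S i j = 2 • ∑ i, ∑ j, if i < j then S i j else 0 := by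
  have hsplit (i j : ι) :
      S i j = (if i < j then S i j else 0) + if j < i then S j i else 0 := by
    rcases lt_trichotomy i j with h | rfl | h
    · simp [h, h.not_gt]
    · simp [hdiag]
    · simp [h, h.not_gt, hsymm i j]
  have hswap : ∑ i, ∑ j, (if j < i then S j i else 0) = ∑ i, ∑ j, if i < j then S i j else 0 :=
    Finset.sum_comm
  rw [two_nsmul]
  nth_rewrite 2 [← hswap]
  simp only [← Finset.sum_add_distrib, ← hsplit]

theorem sum_lt_polyRot_polyRot {n k : ℕ} {p : MvPolynomial (Fin n) ℝ}
    (hp : p ∈ solidHarmonics (Fin n) ℝ k) :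
    (∑ i, ∑ j, if i < j then polyRot i j (polyRot i j p) else 0) = -(C (eigval n k) * p) := by
  have hpairs := sum_sum_eq_two_nsmul_sum_sum_lt (fun i j => polyRot_polyRot_swap i j p)
    fun i => polyRot_self i _
  obtain ⟨hhom, hharm⟩ := mem_solidHarmonics.1 hp
  rw [sum_polyRot_polyRot_of_isHomogeneous hhom, hharm, mul_zero, zero_sub, Fintype.card_fin,
    nsmul_eq_mul, Nat.cast_ofNat] at hpairs
  refine (mul_left_cancel₀ two_ne_zero hpairs).symm.trans ?_
  rw [eigval, add_sub_assoc]

variable {n : ℕ}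

/-- Real polynomials as complex-valued functions on `ℝⁿ`. -/
def polyFun : MvPolynomial (Fin n) ℝ →ₐ[ℝ] EuclideanSpace ℝ (Fin n) → ℂ :=
  aeval fun i x => (x i : ℂ)

theorem polyFun_X (i : Fin n) (x : EuclideanSpace ℝ (Fin n)) : polyFun (X i) x = x i := by
  rw [polyFun, aeval_X]

theorem polyFun_C (a : ℝ) (x : EuclideanSpace ℝ (Fin n)) : polyFun (C a) x = a := by
  rw [polyFun, aeval_C]
  rfl

theorem polyFun_apply (p : MvPolynomial (Fin n) ℝ) (x : EuclideanSpace ℝ (Fin n)) :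
    polyFun p x = (eval (fun i => x i) p : ℝ) := by
  induction p using MvPolynomial.induction_on with
  | C a => rw [polyFun_C, eval_C]
  | add p q hp hq => rw [map_add, Pi.add_apply, hp, hq, map_add, Complex.ofReal_add]
  | mul_X p i hp => rw [map_mul, Pi.mul_apply, hp, polyFun_X, map_mul, eval_X, Complex.ofReal_mul]

theorem polyFun_X_eq_ofRealCLM_comp (i : Fin n) :
    polyFun (X i) = Complex.ofRealCLM.comp (EuclideanSpace.proj (𝕜 := ℝ) i) :=
  funext fun x => polyFun_X i x

theorem contDiff_polyFun (p : MvPolynomial (Fin n) ℝ) : ContDiff ℝ (⊤ : ℕ∞) (polyFun p) := by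
  induction p using MvPolynomial.induction_on with
  | C a => rw [funext (polyFun_C a)]; exact contDiff_const
  | add p q hp hq => rw [map_add]; exact hp.add hq
  | mul_X p i hp =>
    rw [map_mul, polyFun_X_eq_ofRealCLM_comp]
    exact hp.mul (ContinuousLinearMap.contDiff _)

theorem differentiable_polyFun (p : MvPolynomial (Fin n) ℝ) : Differentiable ℝ (polyFun p) :=
  (contDiff_polyFun p).differentiable (by simp)

theorem continuous_polyFun (p : MvPolynomial (Fin n) ℝ) : Continuous (polyFun p) :=
  (contDiff_polyFun p).continuous

theorem fderiv_polyFun (p : MvPolynomial (Fin n) ℝ) (x : EuclideanSpace ℝ (Fin n))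
    (j : Fin n) : fderiv ℝ (polyFun p) x (EuclideanSpace.single j 1) = polyFun (pderiv j p) x := by
  induction p using MvPolynomial.induction_on with
  | C a =>
    rw [show polyFun (C a) = fun _ => (a : ℂ) from funext (polyFun_C a), fderiv_fun_const,
      pderiv_C, map_zero]
    rfl
  | add p q hp hq =>
    rw [map_add, fderiv_add (differentiable_polyFun p x) (differentiable_polyFun q x),
      add_apply, hp, hq, map_add, map_add, Pi.add_apply]
  | mul_X p i hp =>
    have hX : fderiv ℝ (polyFun (X i)) x (EuclideanSpace.single j 1) =
        polyFun (pderiv j (X i)) x := by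
      rw [polyFun_X_eq_ofRealCLM_comp, ContinuousLinearMap.fderiv, pderiv_X]
      by_cases h : i = j <;> simp [h]
    rw [map_mul, fderiv_mul (differentiable_polyFun p x) (differentiable_polyFun _ x)]
    simp only [add_apply, smul_apply, hp, hX, Derivation.leibniz, map_add, map_mul, smul_eq_mul,
      Pi.add_apply, Pi.mul_apply]

theorem rot_polyFun (i j : Fin n) (p : MvPolynomial (Fin n) ℝ) :
    rot i j (polyFun p) = polyFun (polyRot i j p) := by
  funext x
  simp only [rot, fderiv_polyFun, polyRot_apply, map_sub, map_mul, Pi.sub_apply, Pi.mul_apply,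
    polyFun_X]

theorem lapBeltrami_polyFun {k : ℕ} {p : MvPolynomial (Fin n) ℝ}
    (hp : p ∈ solidHarmonics (Fin n) ℝ k) (x : EuclideanSpace ℝ (Fin n)) :
    lapBeltrami (polyFun p) x = -(eigval n k * polyFun p x) := by
  have h := congrFun (congrArg polyFun (sum_lt_polyRot_polyRot hp)) x
  simpa only [lapBeltrami, rot_polyFun, map_sum, Finset.sum_apply, apply_ite (polyFun (n := n)),
    ite_apply, map_zero, Pi.zero_apply, map_neg, map_mul, Pi.neg_apply, Pi.mul_apply,
    polyFun_C] using h

theorem eval_polyNormSq (x : Sph n) :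
    eval (fun i => (x : EuclideanSpace ℝ (Fin n)) i) polyNormSq = 1 := by
  have h := EuclideanSpace.real_norm_sq_eq (x : EuclideanSpace ℝ (Fin n))
  rw [norm_eq_of_mem_sphere, one_pow] at h
  simp [polyNormSq, ← h]

end PolyFun

section RotationInvariance

open Metric
open scoped Pointwise

variable {E : Type*} [NormedAddCommGroup E] [InnerProductSpace ℝ E]

/-- The restriction to the unit sphere of a linear isometry. -/
def sphereMap (L : E ≃ₗᵢ[ℝ] E) (ω : sphere (0 : E) 1) : sphere (0 : E) 1 :=
  ⟨L ω, by simp⟩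

theorem continuous_sphereMap (L : E ≃ₗᵢ[ℝ] E) : Continuous (sphereMap L) :=
  (L.continuous.comp continuous_subtype_val).subtype_mk _

theorem smul_image_sphereMap_preimage (L : E ≃ₗᵢ[ℝ] E) (I : Set ℝ) (s : Set (sphere (0 : E) 1)) :
    I • (Subtype.val '' (sphereMap L ⁻¹' s)) = L ⁻¹' (I • (Subtype.val '' s)) := by
  ext x
  simp only [Set.mem_smul, Set.mem_image, Set.mem_preimage]
  constructor
  · rintro ⟨t, ht, _, ⟨ω, hω, rfl⟩, rfl⟩
    exact ⟨t, ht, _, ⟨sphereMap L ω, hω, rfl⟩, (map_smul L t _).symm⟩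
  · rintro ⟨t, ht, _, ⟨ω, hω, rfl⟩, h⟩
    have hinv : sphereMap L (sphereMap L.symm ω) = ω := Subtype.ext (L.apply_symm_apply ω)
    exact ⟨t, ht, _, ⟨sphereMap L.symm ω, hinv.symm ▸ hω, rfl⟩,
      L.injective (by rw [← h, map_smul]; exact congrArg (t • ·) (L.apply_symm_apply _))⟩

section SkewFlow

variable [CompleteSpace E] {A : E →L[ℝ] E}

/-- The one-parameter group `t ↦ exp (t A)` of isometries generated by a skew-adjoint `A`. -/
def skewFlow (hA : A ∈ skewAdjoint (E →L[ℝ] E)) (t : ℝ) : E ≃ₗᵢ[ℝ] E :=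
  letI : NormedAlgebra ℚ (E →L[ℝ] E) := .restrictScalars ℚ ℝ _
  Unitary.linearIsometryEquiv ⟨NormedSpace.exp (t • A),
    NormedSpace.exp_mem_unitary_of_mem_skewAdjoint (skewAdjoint.smul_mem t hA)⟩

theorem hasDerivAt_skewFlow (hA : A ∈ skewAdjoint (E →L[ℝ] E)) (x : E) (t : ℝ) :
    HasDerivAt (fun u => skewFlow hA u x) (skewFlow hA t (A x)) t :=
  (ContinuousLinearMap.apply ℝ E x).hasFDerivAt.comp_hasDerivAt t (hasDerivAt_exp_smul_const A t)

theorem skewFlow_zero (hA : A ∈ skewAdjoint (E →L[ℝ] E)) (x : E) : skewFlow hA 0 x = x := by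
  change NormedSpace.exp ((0 : ℝ) • A) x = x
  rw [zero_smul, NormedSpace.exp_zero, one_apply_eq_self]

end SkewFlow

variable [FiniteDimensional ℝ E] [MeasurableSpace E] [BorelSpace E]

theorem measurePreserving_sphereMap (L : E ≃ₗᵢ[ℝ] E) :
    MeasurePreserving (sphereMap L) (volume : Measure E).toSphere
      (volume : Measure E).toSphere := by
  have hm := (continuous_sphereMap L).measurable
  refine ⟨hm, Measure.ext fun s hs => ?_⟩
  rw [Measure.map_apply hm hs, Measure.toSphere_apply' _ (hm hs), Measure.toSphere_apply' _ hs,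
    smul_image_sphereMap_preimage]
  congr 1
  exact L.measurePreserving.measure_preimage_equiv (f := L.toMeasurableEquiv) _

variable {F : Type*} [NormedAddCommGroup F]

theorem integrable_sphere_of_continuous {f : E → F} (hf : Continuous f) :
    Integrable (fun ω : sphere (0 : E) 1 => f ω) (volume : Measure E).toSphere :=
  (hf.comp continuous_subtype_val).integrable_of_hasCompactSupport
    (HasCompactSupport.of_compactSpace _)

variable [NormedSpace ℝ F]

theorem integral_sphere_comp_linearIsometryEquiv (L : E ≃ₗᵢ[ℝ] E) (f : E → F) :
    ∫ ω : sphere (0 : E) 1, f (L ω) ∂(volume : Measure E).toSphere =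
      ∫ ω : sphere (0 : E) 1, f ω ∂(volume : Measure E).toSphere := by
  have hemb : MeasurableEmbedding (sphereMap L) :=
    ((continuous_sphereMap L).isClosedEmbedding fun _ _ h =>
      Subtype.ext (L.injective (congrArg Subtype.val h))).measurableEmbedding
  exact (measurePreserving_sphereMap L).integral_comp hemb fun ω => f ω

/-- Differentiate the constant function `t ↦ ∫ φ (exp (t A) ω) dσ(ω)` at `t = 0`. -/
theorem integral_fderiv_skewAdjoint_eq_zero {φ : E → F} (hφ : ContDiff ℝ 1 φ)
    {A : E →L[ℝ] E} (hA : A ∈ skewAdjoint (E →L[ℝ] E)) :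
    ∫ ω : sphere (0 : E) 1, fderiv ℝ φ ω (A ω) ∂(volume : Measure E).toSphere = 0 := by
  obtain ⟨M, hM⟩ := (isCompact_sphere (0 : E) 1).exists_bound_of_continuousOn
    (hφ.continuous_fderiv one_ne_zero).continuousOn
  have hbound (t : ℝ) (ω : sphere (0 : E) 1) :
      ‖fderiv ℝ φ (skewFlow hA t ω) (skewFlow hA t (A ω))‖ ≤ M * ‖A‖ := by
    have hM' : ‖fderiv ℝ φ (skewFlow hA t ω)‖ ≤ M := hM _ (sphereMap (skewFlow hA t) ω).2
    refine (ContinuousLinearMap.le_opNorm _ _).trans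
      (mul_le_mul hM' ?_ (norm_nonneg _) ((norm_nonneg _).trans hM'))
    simpa using A.le_opNorm (ω : E)
  have hderiv := (hasDerivAt_integral_of_dominated_loc_of_deriv_le
    (μ := (volume : Measure E).toSphere) (𝕜 := ℝ)
    (F := fun t (ω : sphere (0 : E) 1) => φ (skewFlow hA t ω)) (x₀ := 0) univ_mem
    (Eventually.of_forall fun t => (integrable_sphere_of_continuous
      (hφ.continuous.comp (skewFlow hA t).continuous)).aestronglyMeasurable)
    (integrable_sphere_of_continuous (hφ.continuous.comp (skewFlow hA 0).continuous))
    (integrable_sphere_of_continuous (((hφ.continuous_fderiv one_ne_zero).comp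
      (skewFlow hA 0).continuous).clm_apply
        ((skewFlow hA 0).continuous.comp A.continuous))).aestronglyMeasurable
    (Eventually.of_forall fun ω t _ => hbound t ω) (integrable_const _)
    (Eventually.of_forall fun ω t _ =>
      ((hφ.differentiable one_ne_zero) _).hasFDerivAt.comp_hasDerivAt t
        (hasDerivAt_skewFlow hA (ω : E) t))).2
  simp only [integral_sphere_comp_linearIsometryEquiv] at hderiv
  simpa only [skewFlow_zero] using hderiv.unique (hasDerivAt_const (0 : ℝ) _)

end RotationInvariance

section IntegrationByParts

variable {n : ℕ} {φ ψ : EuclideanSpace ℝ (Fin n) → ℂ}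

/-- The infinitesimal rotation `x ↦ x_i e_j - x_j e_i`. -/
def planeGen (i j : Fin n) : EuclideanSpace ℝ (Fin n) →L[ℝ] EuclideanSpace ℝ (Fin n) :=
  (EuclideanSpace.proj i : EuclideanSpace ℝ (Fin n) →L[ℝ] ℝ).smulRight
      (EuclideanSpace.single j 1) -
    (EuclideanSpace.proj j : EuclideanSpace ℝ (Fin n) →L[ℝ] ℝ).smulRight
      (EuclideanSpace.single i 1)

theorem planeGen_apply (i j : Fin n) (x : EuclideanSpace ℝ (Fin n)) :
    planeGen i j x = x i • EuclideanSpace.single j 1 - x j • EuclideanSpace.single i 1 := rfl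

theorem planeGen_mem_skewAdjoint (i j : Fin n) :
    planeGen i j ∈ skewAdjoint (EuclideanSpace ℝ (Fin n) →L[ℝ] EuclideanSpace ℝ (Fin n)) := by
  rw [skewAdjoint.mem_iff, ContinuousLinearMap.star_eq_adjoint, eq_comm,
    ContinuousLinearMap.eq_adjoint_iff]
  intro x y
  simp only [neg_apply, planeGen_apply, inner_neg_left, inner_sub_left, inner_sub_right,
    inner_smul_left, inner_smul_right, EuclideanSpace.inner_single_left,
    EuclideanSpace.inner_single_right, map_one, conj_trivial, one_mul]
  ring

theorem rot_eq_fderiv_planeGen (i j : Fin n) (φ : EuclideanSpace ℝ (Fin n) → ℂ)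
    (x : EuclideanSpace ℝ (Fin n)) : rot i j φ x = fderiv ℝ φ x (planeGen i j x) := by
  rw [planeGen_apply, map_sub, map_smul, map_smul, rot, Complex.real_smul, Complex.real_smul]

theorem contDiff_rot (i j : Fin n) (hφ : ContDiff ℝ (⊤ : ℕ∞) φ) :
    ContDiff ℝ (⊤ : ℕ∞) (rot i j φ) := by
  rw [funext (rot_eq_fderiv_planeGen i j φ)]
  exact (hφ.fderiv_right (by simp)).clm_apply (planeGen i j).contDiff

theorem contDiff_lapBeltrami (hφ : ContDiff ℝ (⊤ : ℕ∞) φ) :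
    ContDiff ℝ (⊤ : ℕ∞) (lapBeltrami φ) := by
  refine ContDiff.sum fun i _ => ContDiff.sum fun j _ => ?_
  split_ifs
  · exact contDiff_rot i j (contDiff_rot i j hφ)
  · exact contDiff_const

theorem rot_fun_mul (i j : Fin n) {x : EuclideanSpace ℝ (Fin n)} (hφ : DifferentiableAt ℝ φ x)
    (hψ : DifferentiableAt ℝ ψ x) :
    rot i j (fun y => φ y * ψ y) x = rot i j φ x * ψ x + φ x * rot i j ψ x := by
  simp only [rot_eq_fderiv_planeGen, fderiv_fun_mul hφ hψ, add_apply, smul_apply, smul_eq_mul]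
  ring

theorem integral_rot_eq_zero (i j : Fin n) (hφ : ContDiff ℝ 1 φ) :
    ∫ ω : Sph n, rot i j φ ω ∂(surf n) = 0 := by
  simp only [rot_eq_fderiv_planeGen]
  exact integral_fderiv_skewAdjoint_eq_zero hφ (planeGen_mem_skewAdjoint i j)

theorem integrable_sphere_mul (hφ : Continuous φ) (hψ : Continuous ψ) :
    Integrable (fun ω : Sph n => φ ω * ψ ω) (surf n) :=
  integrable_sphere_of_continuous (hφ.mul hψ)

theorem integral_rot_mul (i j : Fin n) (hφ : ContDiff ℝ (⊤ : ℕ∞) φ) (hψ : ContDiff ℝ (⊤ : ℕ∞) ψ) :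
    ∫ ω : Sph n, rot i j φ ω * ψ ω ∂(surf n) = -∫ ω : Sph n, φ ω * rot i j ψ ω ∂(surf n) := by
  have hle : (1 : WithTop ℕ∞) ≤ (⊤ : ℕ∞) := by exact_mod_cast le_top
  have h := integral_rot_eq_zero i j ((hφ.mul hψ).of_le hle)
  simp only [fun x => rot_fun_mul i j (hφ.differentiable (by simp) x)
    (hψ.differentiable (by simp) x)] at h
  rw [integral_add (integrable_sphere_mul (contDiff_rot i j hφ).continuous hψ.continuous)
    (integrable_sphere_mul hφ.continuous (contDiff_rot i j hψ).continuous)] at h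
  exact eq_neg_of_add_eq_zero_left h

theorem integral_lapBeltrami_mul_eq_neg_sum (hφ : ContDiff ℝ (⊤ : ℕ∞) φ)
    (hψ : ContDiff ℝ (⊤ : ℕ∞) ψ) :
    ∫ ω : Sph n, lapBeltrami φ ω * ψ ω ∂(surf n) =
      -∑ i, ∑ j, if i < j then ∫ ω : Sph n, rot i j φ ω * rot i j ψ ω ∂(surf n) else 0 := by
  have hint (i j : Fin n) : Integrable
      (fun ω : Sph n => if i < j then rot i j (rot i j φ) ω * ψ ω else 0) (surf n) := by
    split_ifs
    · exact integrable_sphere_mul (contDiff_rot i j (contDiff_rot i j hφ)).continuous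
        hψ.continuous
    · exact integrable_zero _ _ _
  simp only [lapBeltrami, Finset.sum_mul, ite_mul, zero_mul, ← Finset.sum_neg_distrib]
  rw [integral_finsetSum _ fun i _ => integrable_finsetSum _ fun j _ => hint i j]
  refine Finset.sum_congr rfl fun i _ => ?_
  rw [integral_finsetSum _ fun j _ => hint i j]
  refine Finset.sum_congr rfl fun j _ => ?_
  split_ifs
  · exact integral_rot_mul i j (contDiff_rot i j hφ) hψ
  · rw [integral_zero, neg_zero]

theorem integral_lapBeltrami_mul (hφ : ContDiff ℝ (⊤ : ℕ∞) φ) (hψ : ContDiff ℝ (⊤ : ℕ∞) ψ) :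
    ∫ ω : Sph n, lapBeltrami φ ω * ψ ω ∂(surf n) =
      ∫ ω : Sph n, φ ω * lapBeltrami ψ ω ∂(surf n) := by
  simp only [mul_comm (φ _), integral_lapBeltrami_mul_eq_neg_sum hφ hψ,
    integral_lapBeltrami_mul_eq_neg_sum hψ hφ, mul_comm (rot _ _ ψ _)]

variable {k : ℕ} {p : MvPolynomial (Fin n) ℝ}

theorem integral_shifted_mul_polyFun (hp : p ∈ solidHarmonics (Fin n) ℝ k)
    (hφ : ContDiff ℝ (⊤ : ℕ∞) φ) (lam : ℝ) :
    ∫ ω : Sph n, (lapBeltrami φ ω + lam * φ ω) * polyFun p ω ∂(surf n) =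
      (lam - eigval n k) * ∫ ω : Sph n, φ ω * polyFun p ω ∂(surf n) := by
  have hint := integrable_sphere_mul (contDiff_lapBeltrami hφ).continuous (continuous_polyFun p)
  have hint' := integrable_sphere_mul hφ.continuous (continuous_polyFun p)
  simp only [add_mul, mul_assoc]
  rw [integral_add hint (hint'.const_mul _), integral_const_mul,
    integral_lapBeltrami_mul hφ (contDiff_polyFun p)]
  simp only [lapBeltrami_polyFun hp, mul_neg, mul_left_comm (φ _), integral_neg,
    integral_const_mul]
  ring

theorem lapBeltrami_const (a : ℂ) (x : EuclideanSpace ℝ (Fin n)) :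
    lapBeltrami (fun _ => a) x = 0 := by
  have hrot (i j : Fin n) (c : ℂ) : rot i j (fun _ => c) = fun _ => 0 := by
    funext y
    simp [rot]
  simp [lapBeltrami, hrot]

theorem integral_polyFun_eq_zero (hn : 2 ≤ n) (hk : k ≠ 0)
    (hp : p ∈ solidHarmonics (Fin n) ℝ k) :
    ∫ ω : Sph n, polyFun p ω ∂(surf n) = 0 := by
  have h := integral_shifted_mul_polyFun hp (φ := fun _ => 1) contDiff_const 0
  simp only [lapBeltrami_const, Complex.ofReal_zero, zero_mul, add_zero, integral_zero,
    one_mul, zero_sub] at h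
  have heig : eigval n k ≠ 0 := by
    simpa [eigval] using (eigval_injective hn).ne hk
  exact (mul_eq_zero.1 h.symm).resolve_left (neg_ne_zero.2 (Complex.ofReal_ne_zero.2 heig))

end IntegrationByParts

section FunkHecke

/-- The total mass of the surface measure. -/
def sphArea (n : ℕ) : ℝ := (surf n).real univ

/-- The Funk–Hecke coefficient of the monomial `t ^ j` in degree `k`: integration against
`⟨θ, ω⟩ ^ j` multiplies spherical harmonics of degree `k` by `sphArea n * funkHecke n j k`. -/
def funkHecke (n j k : ℕ) : ℝ :=
  if k ≤ j ∧ Even (j - k) then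
    j.factorial * Real.Gamma (n / 2) /
      (2 ^ j * ((j - k) / 2).factorial * Real.Gamma (n / 2 + ((j + k) / 2 : ℕ)))
  else 0

theorem funkHecke_add_two_mul (n k m : ℕ) :
    funkHecke n (k + 2 * m) k = (k + 2 * m).factorial * Real.Gamma (n / 2) /
      (2 ^ (k + 2 * m) * m.factorial * Real.Gamma (n / 2 + (k + m : ℕ))) := by
  rw [funkHecke, if_pos ⟨by omega, by simp⟩, show (k + 2 * m + k) / 2 = k + m by omega,
    show (k + 2 * m - k) / 2 = m by omega]

theorem funkHecke_eq_zero {n j k : ℕ} (h : ∀ m, j ≠ k + 2 * m) : funkHecke n j k = 0 := by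
  rw [funkHecke, if_neg]
  rintro ⟨hkj, m, hm⟩
  exact h m (by omega)

theorem funkHecke_zero_zero {n : ℕ} (hn : n ≠ 0) : funkHecke n 0 0 = 1 := by
  have hΓ : Real.Gamma ((n : ℝ) / 2) ≠ 0 := (Real.Gamma_pos_of_pos (by positivity)).ne'
  simp [funkHecke, hΓ]

theorem funkHecke_succ_zero (n j : ℕ) : funkHecke n (j + 1) 0 = funkHecke n j 1 := by
  by_cases h : ∃ m, j = 1 + 2 * m
  · obtain ⟨m, rfl⟩ := h
    have hstep := funkHecke_add_two_mul n 0 (m + 1)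
    rw [show 0 + 2 * (m + 1) = 1 + 2 * m + 1 by ring, show 0 + (m + 1) = 1 + m by ring] at hstep
    rw [hstep, funkHecke_add_two_mul, Nat.factorial_succ (1 + 2 * m), Nat.factorial_succ m,
      pow_succ]
    push_cast
    field_simp
    ring
  · push Not at h
    rw [funkHecke_eq_zero h, funkHecke_eq_zero]
    rintro (_ | m) hm
    · omega
    · exact h m (by omega)

theorem funkHecke_succ_succ {n : ℕ} (hn : n ≠ 0) (j k : ℕ) :
    funkHecke n (j + 1) (k + 1) * (2 * k + n) =
      funkHecke n j (k + 2) * (k + n - 1) + funkHecke n j k * (k + 1) := by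
  by_cases h : ∃ m, j = k + 2 * m
  · obtain ⟨m, rfl⟩ := h
    have hpos : (0 : ℝ) < n / 2 + (k + m : ℕ) := by positivity
    have hΓ := Real.Gamma_add_one hpos.ne'
    have hΓ' := (Real.Gamma_pos_of_pos hpos).ne'
    rw [show k + 2 * m + 1 = k + 1 + 2 * m by ring, funkHecke_add_two_mul, funkHecke_add_two_mul,
      show k + 1 + 2 * m = k + 2 * m + 1 by ring, show k + 1 + m = k + m + 1 by ring,
      Nat.cast_add_one (k + m), ← add_assoc, hΓ, Nat.factorial_succ (k + 2 * m), pow_succ]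
    rcases m with _ | m
    · rw [funkHecke_eq_zero (n := n) (k := k + 2) (fun m => by omega)]
      push_cast at hpos hΓ' ⊢
      field_simp
      ring
    · have hprev := funkHecke_add_two_mul n (k + 2) m
      rw [show k + 2 + 2 * m = k + 2 * (m + 1) by ring, show k + 2 + m = k + (m + 1) + 1 by ring,
        Nat.cast_add_one (k + (m + 1)), ← add_assoc, hΓ] at hprev
      rw [hprev, Nat.factorial_succ m]
      push_cast at hpos hΓ' ⊢
      field_simp
      ring
  · push Not at h
    rw [funkHecke_eq_zero h, funkHecke_eq_zero (k := k + 2) fun m hm => h (m + 1) (by omega),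
      funkHecke_eq_zero fun m hm => h m (by omega)]
    simp

open MvPolynomial

variable {n k : ℕ} {p : MvPolynomial (Fin n) ℝ}

/-- The linear form `x ↦ ⟨θ, x⟩` as a polynomial. -/
def innerPoly (θ : EuclideanSpace ℝ (Fin n)) : MvPolynomial (Fin n) ℝ := ∑ i, C (θ i) * X i

theorem polyFun_innerPoly (θ x : EuclideanSpace ℝ (Fin n)) :
    polyFun (innerPoly θ) x = (inner ℝ θ x : ℝ) := by
  simp only [innerPoly, map_sum, Finset.sum_apply, map_mul, Pi.mul_apply, polyFun_C, polyFun_X,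
    PiLp.inner_apply, RCLike.inner_apply', conj_trivial, Complex.ofReal_sum, Complex.ofReal_mul]

theorem integrable_polyFun (p : MvPolynomial (Fin n) ℝ) :
    Integrable (fun ω : Sph n => polyFun p ω) (surf n) :=
  integrable_sphere_of_continuous (continuous_polyFun p)

theorem polyFun_X_mul_sphere (i : Fin n) (p : MvPolynomial (Fin n) ℝ) (ω : Sph n) :
    (ω : EuclideanSpace ℝ (Fin n)) i * polyFun p ω =
      polyFun (raiseHarmonic k i p) ω + (2 * k + n - 2 : ℝ)⁻¹ * polyFun (pderiv i p) ω := by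
  have hnorm : polyFun polyNormSq (ω : EuclideanSpace ℝ (Fin n)) = 1 := by
    rw [polyFun_apply, eval_polyNormSq, Complex.ofReal_one]
  simp only [raiseHarmonic, map_sub, map_mul, Pi.sub_apply, Pi.mul_apply, polyFun_X, polyFun_C,
    hnorm, Fintype.card_fin]
  ring

theorem integral_mul_innerPoly_mul (q : MvPolynomial (Fin n) ℝ) (k : ℕ) (θ : Sph n) :
    ∫ ω : Sph n, polyFun (q * innerPoly θ * p) ω ∂(surf n) =
      ∑ i, (θ : EuclideanSpace ℝ (Fin n)) i *
        ((∫ ω : Sph n, polyFun (q * raiseHarmonic k i p) ω ∂(surf n)) +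
          (2 * k + n - 2 : ℝ)⁻¹ * ∫ ω : Sph n, polyFun (q * pderiv i p) ω ∂(surf n)) := by
  have hpt (ω : Sph n) : polyFun (q * innerPoly θ * p) (ω : EuclideanSpace ℝ (Fin n)) =
      ∑ i, (θ : EuclideanSpace ℝ (Fin n)) i * (polyFun (q * raiseHarmonic k i p) ω +
        (2 * k + n - 2 : ℝ)⁻¹ * polyFun (q * pderiv i p) ω) := by
    simp only [innerPoly, map_mul, map_sum, Pi.mul_apply, Finset.sum_apply, polyFun_C, polyFun_X,
      Finset.mul_sum, Finset.sum_mul]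
    refine Finset.sum_congr rfl fun i _ => ?_
    linear_combination polyFun q ω * (θ : EuclideanSpace ℝ (Fin n)) i *
      polyFun_X_mul_sphere (k := k) i p ω
  have hint (i : Fin n) := (integrable_polyFun (q * raiseHarmonic k i p)).add
    ((integrable_polyFun (q * pderiv i p)).const_mul ((2 * k + n - 2 : ℝ)⁻¹ : ℂ))
  simp only [hpt]
  rw [integral_finsetSum _ fun i _ => by simpa using (hint i).const_mul _]
  refine Finset.sum_congr rfl fun i _ => ?_
  rw [integral_const_mul, integral_add (integrable_polyFun _) ((integrable_polyFun _).const_mul _),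
    integral_const_mul]

theorem sum_mul_polyFun_pderiv (hp : p ∈ solidHarmonics (Fin n) ℝ k)
    (x : EuclideanSpace ℝ (Fin n)) : ∑ i, (x i : ℂ) * polyFun (pderiv i p) x = k * polyFun p x := by
  have h := congrFun (congrArg polyFun
    (sum_X_mul_pderiv_of_isHomogeneous (mem_solidHarmonics.1 hp).1)) x
  simpa only [map_sum, Finset.sum_apply, map_mul, Pi.mul_apply, polyFun_X, polyFun_C,
    Complex.ofReal_natCast] using h

theorem sum_sq_sphere (θ : Sph n) : ∑ i, ((θ : EuclideanSpace ℝ (Fin n)) i : ℂ) ^ 2 = 1 := by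
  have h := EuclideanSpace.real_norm_sq_eq (θ : EuclideanSpace ℝ (Fin n))
  rw [norm_eq_of_mem_sphere, one_pow] at h
  exact_mod_cast h.symm

theorem integral_polyFun_eq (hn : 2 ≤ n) (hp : p ∈ solidHarmonics (Fin n) ℝ k) (θ : Sph n) :
    ∫ ω : Sph n, polyFun p ω ∂(surf n) = sphArea n * funkHecke n 0 k * polyFun p θ := by
  rcases k with _ | k
  · obtain ⟨a, rfl⟩ : ∃ a, p = C a := ⟨_, totalDegree_eq_zero_iff_eq_C.1
      (Nat.le_zero.1 (mem_solidHarmonics.1 hp).1.totalDegree_le)⟩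
    simp [polyFun_C, funkHecke_zero_zero (by omega : n ≠ 0), sphArea]
  · rw [integral_polyFun_eq_zero hn k.succ_ne_zero hp, funkHecke_eq_zero fun m => by omega]
    simp

theorem funkHecke_succ_eq {n : ℕ} (hn : n ≠ 0) (j k : ℕ) :
    funkHecke n (j + 1) k = funkHecke n j (k + 1) +
      (2 * k + n - 2 : ℝ)⁻¹ * k * (funkHecke n j (k - 1) - funkHecke n j (k + 1)) := by
  rcases k with _ | k
  · simp [funkHecke_succ_zero]
  · have hpos : (0 : ℝ) < 2 * k + n := by positivity
    have hrec := funkHecke_succ_succ hn j k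
    rw [eq_div_of_mul_eq hpos.ne' hrec, Nat.add_sub_cancel,
      show 2 * ((k + 1 : ℕ) : ℝ) + n - 2 = 2 * k + n by push_cast; ring]
    push_cast
    field_simp
    ring

theorem integral_innerPoly_pow_mul (hn : 2 ≤ n) (j : ℕ) (hp : p ∈ solidHarmonics (Fin n) ℝ k)
    (θ : Sph n) :
    ∫ ω : Sph n, polyFun (innerPoly θ ^ j * p) ω ∂(surf n) =
      sphArea n * funkHecke n j k * polyFun p θ := by
  induction j generalizing k p with
  | zero => simpa only [pow_zero, one_mul] using integral_polyFun_eq hn hp θ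
  | succ j ih =>
    have hterm (i : Fin n) := eq_sub_of_add_eq (polyFun_X_mul_sphere (k := k) i p θ).symm
    rw [pow_succ, integral_mul_innerPoly_mul _ k]
    simp only [ih (raiseHarmonic_mem hp _), ih (pderiv_mem_solidHarmonics hp _), hterm]
    calc
      _ = sphArea n * funkHecke n j (k + 1) * polyFun p θ *
            ∑ i, ((θ : EuclideanSpace ℝ (Fin n)) i : ℂ) ^ 2 +
          sphArea n * (2 * k + n - 2 : ℝ)⁻¹ * (funkHecke n j (k - 1) - funkHecke n j (k + 1)) *
            ∑ i, (θ : EuclideanSpace ℝ (Fin n)) i * polyFun (pderiv i p) θ := by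
        rw [Finset.mul_sum, Finset.mul_sum, ← Finset.sum_add_distrib]
        exact Finset.sum_congr rfl fun i _ => by ring
      _ = _ := by
        rw [sum_sq_sphere, sum_mul_polyFun_pderiv hp, funkHecke_succ_eq (by omega : n ≠ 0)]
        push_cast
        ring

end FunkHecke

section PlaneWave

open MvPolynomial

variable {n k : ℕ} {p : MvPolynomial (Fin n) ℝ}

/-- The radial factor of the Fourier transform of a spherical harmonic of degree `k`, which is
`Γ(n/2) (r/2)^(1 - n/2) J_{n/2 - 1 + k}(r)` for `r > 0`. -/
def radialBessel (n k : ℕ) (r : ℝ) : ℝ :=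
  Real.Gamma (n / 2) * ((r / 2) ^ k * besselSeries (besselOrder n k) (-(r ^ 2 / 4)))

theorem sphArea_mul_Gamma (hn : 2 ≤ n) :
    sphArea n * Real.Gamma (n / 2) = 2 * Real.pi ^ ((n : ℝ) / 2) := by
  have : NeZero n := ⟨by omega⟩
  have hball : (volume : Measure (EuclideanSpace ℝ (Fin n))).real (Metric.ball 0 1) =
      √Real.pi ^ n / Real.Gamma (n / 2 + 1) := by
    simp only [measureReal_def, EuclideanSpace.volume_ball, ENNReal.ofReal_one, one_pow, one_mul,
      Fintype.card_fin]
    have := Real.Gamma_pos_of_pos (by positivity : (0 : ℝ) < n / 2 + 1)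
    exact ENNReal.toReal_ofReal (by positivity)
  have hhalf : (0 : ℝ) < n / 2 := by positivity
  have hsqrt : √Real.pi ^ n = Real.pi ^ ((n : ℝ) / 2) := by
    rw [Real.sqrt_eq_rpow, ← Real.rpow_mul_natCast Real.pi_nonneg]
    ring_nf
  rw [sphArea, Measure.toSphere_real_apply_univ, finrank_euclideanSpace_fin, hball, hsqrt,
    Real.Gamma_add_one hhalf.ne']
  have := (Real.Gamma_pos_of_pos hhalf).ne'
  field_simp

theorem sphArea_mul_radialBessel (hn : 2 ≤ n) (k : ℕ) {r : ℝ} (hr : 0 < r) :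
    sphArea n * radialBessel n k r =
      (2 * Real.pi) ^ ((n : ℝ) / 2) * r ^ (1 - (n : ℝ) / 2) * besselJ (besselOrder n k) r := by
  have hpow : 2 * Real.pi ^ ((n : ℝ) / 2) * (r / 2) ^ k =
      (2 * Real.pi) ^ ((n : ℝ) / 2) * r ^ (1 - (n : ℝ) / 2) * (r / 2) ^ besselOrder n k := by
    have hsplit : (r / 2) ^ k = (r / 2) ^ (1 - (n : ℝ) / 2) * (r / 2) ^ besselOrder n k := by
      rw [← Real.rpow_natCast, ← Real.rpow_add (by positivity), besselOrder]
      ring_nf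
    have htwo : 2 * (2 : ℝ) ^ ((n : ℝ) / 2 - 1) = 2 ^ ((n : ℝ) / 2) := by
      rw [Real.rpow_sub_one two_ne_zero, mul_div_cancel₀ _ two_ne_zero]
    rw [hsplit, Real.mul_rpow two_pos.le Real.pi_nonneg, Real.div_rpow hr.le two_pos.le, ← htwo,
      ← neg_sub ((n : ℝ) / 2) 1, Real.rpow_neg two_pos.le]
    field_simp
  rw [radialBessel, ← mul_assoc, sphArea_mul_Gamma hn, ← mul_assoc, hpow, besselJ, ← mul_assoc]

theorem hasSum_radialBessel (n k : ℕ) (r : ℝ) :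
    HasSum (fun j : ℕ => (-(Complex.I * r)) ^ j / j.factorial * funkHecke n j k)
      ((-Complex.I) ^ k * radialBessel n k r) := by
  have hinj : Function.Injective fun m : ℕ => k + 2 * m := fun a b h => by
    simp only at h; omega
  rw [← hinj.hasSum_iff]
  · have hreal := ((summable_besselSeries (besselOrder n k) (-(r ^ 2 / 4))).hasSum.mul_left
      ((r / 2) ^ k)).mul_left (Real.Gamma (n / 2))
    refine ((Complex.hasSum_ofReal.2 hreal).mul_left ((-Complex.I) ^ k)).congr_fun fun m => ?_
    have hfac : ((k + 2 * m).factorial : ℂ) ≠ 0 := by exact_mod_cast Nat.factorial_ne_zero _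
    have hI : (-(Complex.I * r)) ^ (k + 2 * m) =
        (-Complex.I) ^ k * ((r : ℂ) ^ k * (-(r : ℂ) ^ 2) ^ m) := by
      rw [← neg_mul, mul_pow, pow_add, pow_add (r : ℂ), pow_mul, pow_mul, neg_sq, Complex.I_sq,
        neg_pow ((r : ℂ) ^ 2)]
      ring
    have hΓ : besselOrder n k + m + 1 = n / 2 + (k + m : ℕ) := by
      rw [besselOrder]
      push_cast
      ring
    simp only [Function.comp_apply, funkHecke_add_two_mul, hΓ]
    push_cast
    rw [hI, pow_add, pow_mul, show -((r : ℂ) ^ 2 / 4) = (-(r : ℂ) ^ 2) / 2 ^ 2 by ring, div_pow,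
      div_pow]
    field_simp
  · intro j hj
    rw [funkHecke_eq_zero fun m hm => hj ⟨m, hm.symm⟩]
    simp

theorem hasSum_planeWave_smul (r : ℝ) (θ ω : Sph n) :
    HasSum (fun j : ℕ => (-(Complex.I * r)) ^ j / j.factorial *
      polyFun (innerPoly (θ : EuclideanSpace ℝ (Fin n)) ^ j) ω)
      (planeWave (r • (θ : EuclideanSpace ℝ (Fin n))) ω) := by
  have hexp := NormedSpace.expSeries_div_hasSum_exp (𝔸 := ℂ)
    (-(Complex.I * r) * polyFun (innerPoly (θ : EuclideanSpace ℝ (Fin n))) ω)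
  have harg : planeWave (r • (θ : EuclideanSpace ℝ (Fin n))) ω =
      Complex.exp (-(Complex.I * r) * polyFun (innerPoly (θ : EuclideanSpace ℝ (Fin n))) ω) := by
    rw [planeWave, inner_smul_left, polyFun_innerPoly, conj_trivial, Complex.ofReal_mul]
    ring_nf
  rw [harg, Complex.exp_eq_exp_ℂ]
  refine hexp.congr_fun fun j => ?_
  rw [map_pow, Pi.pow_apply, mul_pow]
  ring

theorem norm_polyFun_innerPoly_le (θ ω : Sph n) :
    ‖polyFun (innerPoly (θ : EuclideanSpace ℝ (Fin n))) ω‖ ≤ 1 := by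
  rw [polyFun_innerPoly, Complex.norm_real]
  simpa [norm_eq_of_mem_sphere] using
    norm_inner_le_norm (𝕜 := ℝ) (θ : EuclideanSpace ℝ (Fin n)) (ω : EuclideanSpace ℝ (Fin n))

theorem integral_planeWave_mul_polyFun (hn : 2 ≤ n) (hp : p ∈ solidHarmonics (Fin n) ℝ k) (r : ℝ)
    (θ : Sph n) :
    ∫ ω : Sph n, planeWave (r • (θ : EuclideanSpace ℝ (Fin n))) ω * polyFun p ω ∂(surf n) =
      sphArea n * ((-Complex.I) ^ k * radialBessel n k r) * polyFun p θ := by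
  set F : ℕ → Sph n → ℂ := fun j ω => (-(Complex.I * r)) ^ j / j.factorial *
    polyFun (innerPoly (θ : EuclideanSpace ℝ (Fin n)) ^ j * p) ω with hF
  have hFint (j : ℕ) : Integrable (F j) (surf n) := (integrable_polyFun _).const_mul _
  obtain ⟨M, hM⟩ := (isCompact_univ (X := Sph n)).exists_bound_of_continuousOn
    ((continuous_polyFun p).comp continuous_subtype_val).continuousOn
  have hFle (j : ℕ) (ω : Sph n) : ‖F j ω‖ ≤ |r| ^ j / j.factorial * M := by
    simp only [hF, map_mul, map_pow, Pi.mul_apply, Pi.pow_apply, norm_mul, norm_div, norm_pow,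
      norm_neg, Complex.norm_I, one_mul, Complex.norm_real, Complex.norm_natCast,
      Real.norm_eq_abs]
    refine mul_le_mul_of_nonneg_left ?_ (by positivity)
    exact (mul_le_of_le_one_left (norm_nonneg _)
      (pow_le_one₀ (norm_nonneg _) (norm_polyFun_innerPoly_le θ ω))).trans (hM ω (mem_univ _))
  have hsum : Summable fun j => ∫ ω, ‖F j ω‖ ∂(surf n) := by
    refine .of_nonneg_of_le (fun j => integral_nonneg fun _ => norm_nonneg _) (fun j => ?_)
      ((Real.summable_pow_div_factorial |r|).mul_right (M * sphArea n))
    refine (integral_mono (hFint j).norm (integrable_const _) (hFle j)).trans_eq ?_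
    rw [integral_const, smul_eq_mul, sphArea]
    ring
  have htsum (ω : Sph n) : ∑' j, F j ω =
      planeWave (r • (θ : EuclideanSpace ℝ (Fin n))) ω * polyFun p ω := by
    rw [← ((hasSum_planeWave_smul r θ ω).mul_right _).tsum_eq]
    simp only [hF, map_mul, Pi.mul_apply, mul_assoc]
  have hterm (j : ℕ) : ∫ ω, F j ω ∂(surf n) =
      (-(Complex.I * r)) ^ j / j.factorial * funkHecke n j k * (sphArea n * polyFun p θ) := by
    simp only [hF, integral_const_mul, integral_innerPoly_pow_mul hn j hp θ]
    ring
  have hint := hasSum_integral_of_summable_integral_norm hFint hsum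
  simp only [htsum, hterm] at hint
  rw [hint.unique ((hasSum_radialBessel n k r).mul_right _)]
  ring

end PlaneWave

section SphericalHarmonics

open MvPolynomial

variable {n k : ℕ} {p : MvPolynomial (Fin n) ℝ} {f : L2Sph n} {lam mu : ℝ}

/-- Real polynomials as continuous functions on the sphere. -/
def polySph (n : ℕ) : MvPolynomial (Fin n) ℝ →ₐ[ℝ] C(Sph n, ℝ) :=
  aeval fun i => ⟨fun ω => (ω : EuclideanSpace ℝ (Fin n)) i, by fun_prop⟩

theorem polySph_X_apply (i : Fin n) (ω : Sph n) :
    polySph n (X i) ω = (ω : EuclideanSpace ℝ (Fin n)) i := by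
  rw [polySph, aeval_X]
  rfl

theorem polySph_apply (p : MvPolynomial (Fin n) ℝ) (ω : Sph n) :
    polySph n p ω = eval (fun i => (ω : EuclideanSpace ℝ (Fin n)) i) p := by
  induction p using MvPolynomial.induction_on with
  | C a => rw [polySph, aeval_C, eval_C]; rfl
  | add p q hp hq => rw [map_add, ContinuousMap.add_apply, hp, hq, map_add]
  | mul_X p i hp =>
    rw [map_mul, ContinuousMap.mul_apply, hp, polySph_X_apply, map_mul, eval_X]

theorem topologicalClosure_range_polySph (n : ℕ) :
    (polySph n).range.topologicalClosure = ⊤ := by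
  refine ContinuousMap.subalgebra_topologicalClosure_eq_top_of_separatesPoints _ fun x y hxy => ?_
  obtain ⟨i, hi⟩ : ∃ i, (x : EuclideanSpace ℝ (Fin n)) i ≠ (y : EuclideanSpace ℝ (Fin n)) i := by
    by_contra! h
    exact hxy (Subtype.ext (by ext i; exact h i))
  exact ⟨polySph n (X i), ⟨polySph n (X i), ⟨X i, rfl⟩, rfl⟩, by simpa only [polySph_X_apply]⟩

/-- The inclusion of the real continuous functions into the complex space `L²(S^{n-1})`. -/
def ofRealL2 (n : ℕ) : C(Sph n, ℝ) →L[ℝ] L2Sph n :=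
  ((ContinuousMap.toLp (E := ℂ) 2 (surf n) ℂ).restrictScalars ℝ).comp
    (Complex.ofRealCLM.compLeftContinuous ℝ (Sph n))

theorem coeFn_ofRealL2 (u : C(Sph n, ℝ)) : ofRealL2 n u =ᵐ[surf n] fun ω => (u ω : ℂ) :=
  ContinuousMap.coeFn_toLp (p := 2) (𝕜 := ℂ) (surf n) _

theorem toLp_eq_ofRealL2_re_add_im (u : C(Sph n, ℂ)) :
    ContinuousMap.toLp (E := ℂ) 2 (surf n) ℂ u =
      ofRealL2 n (Complex.reCLM.compLeftContinuous ℝ (Sph n) u) +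
        Complex.I • ofRealL2 n (Complex.imCLM.compLeftContinuous ℝ (Sph n) u) := by
  simp only [ofRealL2, ContinuousLinearMap.comp_apply, ContinuousLinearMap.coe_restrictScalars']
  rw [← map_smul, ← map_add]
  congr 1
  ext ω
  change u ω = (u ω).re + Complex.I * (u ω).im
  rw [mul_comm, Complex.re_add_im]

theorem eq_zero_of_inner_ofRealL2 (h : ∀ u, inner ℂ (ofRealL2 n u) f = 0) : f = 0 := by
  refine (inner_self_eq_zero (𝕜 := ℂ)).1 ((ContinuousMap.toLp_denseRange ℂ (surf n) ℂ (p := 2)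
    (by simp)).induction_on (p := fun u => inner ℂ u f = 0) f
    (isClosed_eq (continuous_id.inner continuous_const) continuous_const) fun u => ?_)
  rw [toLp_eq_ofRealL2_re_add_im, inner_add_left, inner_smul_left, h, h, mul_zero, add_zero]

/-- Real polynomials as elements of `L²(S^{n-1})`. -/
def polyL2 (n : ℕ) : MvPolynomial (Fin n) ℝ →ₗ[ℝ] L2Sph n :=
  (ofRealL2 n).toLinearMap ∘ₗ (polySph n).toLinearMap

theorem coeFn_polyL2 (p : MvPolynomial (Fin n) ℝ) :
    polyL2 n p =ᵐ[surf n] fun ω => polyFun p ω :=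
  (coeFn_ofRealL2 (polySph n p)).trans (.of_eq (by simp only [polyFun_apply, polySph_apply]))

theorem polyL2_congr {p q : MvPolynomial (Fin n) ℝ}
    (h : ∀ ω : Sph n, eval (fun i => (ω : EuclideanSpace ℝ (Fin n)) i) p =
      eval (fun i => (ω : EuclideanSpace ℝ (Fin n)) i) q) : polyL2 n p = polyL2 n q :=
  congrArg (ofRealL2 n) (ContinuousMap.ext fun ω =>
    (polySph_apply p ω).trans ((h ω).trans (polySph_apply q ω).symm))

theorem inner_polyL2_left (p : MvPolynomial (Fin n) ℝ) (f : L2Sph n) :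
    inner ℂ (polyL2 n p) f = ∫ ω, polyFun p ω * f ω ∂(surf n) := by
  rw [L2.inner_def]
  refine integral_congr_ae ((coeFn_polyL2 p).mono fun ω hω => ?_)
  simp only [hω, RCLike.inner_apply, polyFun_apply, Complex.conj_ofReal, mul_comm]

theorem eq_zero_of_inner_polyL2 (h : ∀ p, inner ℂ (polyL2 n p) f = 0) : f = 0 := by
  refine eq_zero_of_inner_ofRealL2 fun u => ?_
  have hclosed : IsClosed {u | inner ℂ (ofRealL2 n u) f = 0} :=
    isClosed_eq ((ofRealL2 n).continuous.inner continuous_const) continuous_const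
  have hu : u ∈ (polySph n).range.topologicalClosure := by
    rw [topologicalClosure_range_polySph]
    trivial
  refine closure_minimal ?_ hclosed hu
  rintro _ ⟨p, rfl⟩
  exact h p

theorem eq_zero_of_inner_solidHarmonics
    (h : ∀ k, ∀ p ∈ solidHarmonics (Fin n) ℝ k, inner ℂ (polyL2 n p) f = 0) : f = 0 := by
  refine eq_zero_of_inner_polyL2 fun p => ?_
  obtain ⟨q, hq, hpq⟩ := exists_mem_iSup_solidHarmonics p
  rw [polyL2_congr fun ω => hpq _ (eval_polyNormSq ω)]
  clear hpq
  induction hq using Submodule.iSup_induction' with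
  | mem k q hq => exact h k q hq
  | zero => rw [map_zero, inner_zero_left]
  | add a b _ _ ha hb => rw [map_add, inner_add_left, ha, hb, add_zero]

theorem inner_polyL2_shifted (hp : p ∈ solidHarmonics (Fin n) ℝ k)
    {φ : EuclideanSpace ℝ (Fin n) → ℂ} (hφ : ContDiff ℝ (⊤ : ℕ∞) φ) {u : L2Sph n}
    (hu : u =ᵐ[surf n] fun ω => lapBeltrami φ (ω : EuclideanSpace ℝ (Fin n)) + lam * φ ω) :
    inner ℂ (polyL2 n p) u = (lam - eigval n k) * ∫ ω : Sph n, φ ω * polyFun p ω ∂(surf n) := by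
  rw [inner_polyL2_left, ← integral_shifted_mul_polyFun hp hφ]
  refine integral_congr_ae (hu.mono fun ω hω => ?_)
  simp only [hω, mul_comm]

theorem polyL2_mem_eigenspace (hp : p ∈ solidHarmonics (Fin n) ℝ k) :
    polyL2 n p ∈ eigenspace n (eigval n k) := by
  have hle : Submodule.span ℂ (shiftedRange n (eigval n k)) ≤ (ℂ ∙ polyL2 n p)ᗮ := by
    rw [Submodule.span_le]
    rintro u ⟨φ, hφ, hu⟩
    rw [SetLike.mem_coe, Submodule.mem_orthogonal_singleton_iff_inner_right,
      inner_polyL2_shifted hp hφ hu, sub_self, zero_mul]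
  exact fun u hu => Submodule.mem_orthogonal_singleton_iff_inner_left.1 (hle hu)

theorem inner_polyL2_eq_zero (hp : p ∈ solidHarmonics (Fin n) ℝ k) (hlam : lam ≠ eigval n k)
    (hf : f ∈ eigenspace n lam) : inner ℂ (polyL2 n p) f = 0 := by
  have hmem : ((lam - eigval n k : ℝ) : ℂ) • polyL2 n p ∈ shiftedRange n lam := by
    refine ⟨polyFun p, contDiff_polyFun p, ?_⟩
    filter_upwards [Lp.coeFn_smul ((lam - eigval n k : ℝ) : ℂ) (polyL2 n p), coeFn_polyL2 p]
      with ω hsmul hpoly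
    rw [hsmul, Pi.smul_apply, hpoly, lapBeltrami_polyFun hp, smul_eq_mul, Complex.ofReal_sub]
    ring
  have horth := (Submodule.mem_orthogonal _ _).1 hf _ (Submodule.subset_span hmem)
  rw [inner_smul_left, Complex.conj_ofReal] at horth
  exact (mul_eq_zero.1 horth).resolve_left (Complex.ofReal_ne_zero.2 (sub_ne_zero.2 hlam))

theorem inner_proj_left (lam : ℝ) (f g : L2Sph n) :
    inner ℂ (proj n lam f) g = inner ℂ f (proj n lam g) :=
  Submodule.inner_starProjection_left_eq_right _ f g

theorem proj_mem (lam : ℝ) (f : L2Sph n) : proj n lam f ∈ eigenspace n lam :=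
  Submodule.starProjection_apply_mem _ f

theorem proj_eq_self (hf : f ∈ eigenspace n lam) : proj n lam f = f :=
  Submodule.starProjection_eq_self_iff.2 hf

theorem inner_polyL2_proj_self (hp : p ∈ solidHarmonics (Fin n) ℝ k) (f : L2Sph n) :
    inner ℂ (polyL2 n p) (proj n (eigval n k) f) = inner ℂ (polyL2 n p) f := by
  rw [← inner_proj_left, proj_eq_self (polyL2_mem_eigenspace hp)]

theorem proj_eq_zero_of_mem (hne : lam ≠ mu) (hf : f ∈ eigenspace n mu) :
    proj n lam f = 0 := by
  refine eq_zero_of_inner_solidHarmonics fun k p hp => ?_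
  by_cases hk : lam = eigval n k
  · rw [hk, inner_polyL2_proj_self hp]
    exact inner_polyL2_eq_zero hp (hk ▸ hne.symm) hf
  · exact inner_polyL2_eq_zero hp hk (proj_mem _ _)

theorem proj_eq_zero (hlam : ∀ k, lam ≠ eigval n k) (f : L2Sph n) :
    proj n lam f = 0 :=
  eq_zero_of_inner_solidHarmonics fun k _ hp => inner_polyL2_eq_zero hp (hlam k) (proj_mem _ _)

end SphericalHarmonics

section SphericalHarmonicExpansion

variable {n : ℕ} {f : L2Sph n} {s : ℝ}

theorem orthogonalFamily_eigenspace (hn : 2 ≤ n) :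
    OrthogonalFamily ℂ (fun k => eigenspace n (eigval n k))
      fun k => (eigenspace n (eigval n k)).subtypeₗᵢ := by
  intro j k hjk v w
  have h := proj_eq_zero_of_mem ((eigval_injective hn).ne hjk) w.2
  change inner ℂ (v : L2Sph n) (w : L2Sph n) = 0
  rw [← proj_eq_self v.2, inner_proj_left, h, inner_zero_right]

instance completeSpace_eigenspace (n : ℕ) (lam : ℝ) : CompleteSpace (eigenspace n lam) :=
  (Submodule.isClosed_orthogonal _).completeSpace_coe

theorem isHilbertSum_eigenspace (hn : 2 ≤ n) :
    IsHilbertSum ℂ (fun k => eigenspace n (eigval n k))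
      fun k => (eigenspace n (eigval n k)).subtypeₗᵢ := by
  refine IsHilbertSum.mkInternal (F := fun k => eigenspace n (eigval n k))
    (orthogonalFamily_eigenspace hn) (top_le_iff.2 ?_)
  rw [Submodule.topologicalClosure_eq_top_iff, Submodule.eq_bot_iff]
  intro f hf
  exact eq_zero_of_inner_solidHarmonics fun k p hp => (Submodule.mem_orthogonal _ _).1 hf _
    (Submodule.mem_iSup_of_mem k (polyL2_mem_eigenspace hp))

theorem proj_eigval_eq_of_hasSum (hn : 2 ≤ n) {v : ℕ → L2Sph n} (hv : HasSum v f)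
    (hmem : ∀ k, v k ∈ eigenspace n (eigval n k)) (j : ℕ) : proj n (eigval n j) f = v j := by
  refine (hv.mapL (proj n (eigval n j))).unique ?_
  convert hasSum_ite_eq j (v j) using 2 with k
  split_ifs with hkj
  · rw [hkj, proj_eq_self (hmem j)]
  · exact proj_eq_zero_of_mem ((eigval_injective hn).ne (Ne.symm hkj)) (hmem k)

theorem hasSum_proj (hn : 2 ≤ n) (f : L2Sph n) : HasSum (fun k => proj n (eigval n k) f) f := by
  have hV := isHilbertSum_eigenspace hn
  have h := hV.hasSum_linearIsometryEquiv_symm (hV.linearIsometryEquiv f)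
  rw [LinearIsometryEquiv.symm_apply_apply] at h
  rw [funext (proj_eigval_eq_of_hasSum hn h fun k => (hV.linearIsometryEquiv f k).2)]
  exact h

theorem re_inner_proj_self (lam : ℝ) (f : L2Sph n) :
    (inner ℂ f (proj n lam f)).re = ‖proj n lam f‖ ^ 2 := by
  rw [← proj_eq_self (proj_mem lam f), ← inner_proj_left, proj_eq_self (proj_mem lam f)]
  exact inner_self_eq_norm_sq (𝕜 := ℂ) _

theorem hasSum_norm_sq_proj (hn : 2 ≤ n) (f : L2Sph n) :
    HasSum (fun k => ‖proj n (eigval n k) f‖ ^ 2) (‖f‖ ^ 2) := by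
  have h := ((hasSum_proj hn f).mapL (innerSL ℂ f)).mapL Complex.reCLM
  simp only [innerSL_apply_apply, Complex.reCLM_apply, re_inner_proj_self] at h
  rwa [show (inner ℂ f f).re = ‖f‖ ^ 2 from inner_self_eq_norm_sq (𝕜 := ℂ) f] at h

theorem enorm_sq_eq_tsum (hn : 2 ≤ n) (f : L2Sph n) :
    ‖f‖ₑ ^ 2 = ∑' k, ‖proj n (eigval n k) f‖ₑ ^ 2 := by
  have h := hasSum_norm_sq_proj hn f
  rw [← ofReal_norm, ← ENNReal.ofReal_pow (norm_nonneg _), ← h.tsum_eq,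
    ENNReal.ofReal_tsum_of_nonneg (fun k => by positivity) h.summable]
  exact tsum_congr fun k => by rw [ENNReal.ofReal_pow (norm_nonneg _), ofReal_norm]

/-- The `k`-th eigenvalue of `-Δ_ω`, in the index type of the sums in `angDomain` and `angPow`. -/
def eigvalNN (hn : 2 ≤ n) (k : ℕ) : ℝ≥0 := ⟨eigval n k, eigval_nonneg hn k⟩

theorem eigvalNN_injective (hn : 2 ≤ n) : Function.Injective (eigvalNN hn) := fun _ _ h =>
  eigval_injective hn (congrArg NNReal.toReal h)

theorem proj_eq_zero_of_notMem_range_eigvalNN (hn : 2 ≤ n) {lam : ℝ≥0}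
    (h : lam ∉ range (eigvalNN hn)) (f : L2Sph n) : proj n lam f = 0 :=
  proj_eq_zero (fun k hk => h ⟨k, NNReal.coe_injective hk.symm⟩) f

theorem mem_angDomain_iff (hn : 2 ≤ n) :
    f ∈ angDomain n s ↔ Summable fun k => (1 + eigval n k) ^ s * ‖proj n (eigval n k) f‖ ^ 2 := by
  rw [angDomain, mem_ofPred_eq, ← (eigvalNN_injective hn).summable_iff]
  · rfl
  · intro lam hlam
    simp [proj_eq_zero_of_notMem_range_eigvalNN hn hlam]

theorem one_add_eigval_pos (hn : 2 ≤ n) (k : ℕ) : 0 < 1 + eigval n k := by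
  linarith [eigval_nonneg hn k]

theorem norm_rpow_smul_proj_sq (hn : 2 ≤ n) (s : ℝ) (f : L2Sph n) (k : ℕ) :
    ‖(((1 + eigval n k) ^ (s / 2) : ℝ) : ℂ) • proj n (eigval n k) f‖ ^ 2 =
      (1 + eigval n k) ^ s * ‖proj n (eigval n k) f‖ ^ 2 := by
  have hpos := one_add_eigval_pos hn k
  rw [norm_smul, mul_pow, Complex.norm_real, Real.norm_of_nonneg (by positivity),
    ← Real.rpow_mul_natCast hpos.le, Nat.cast_ofNat, div_mul_cancel₀ s two_ne_zero]

theorem hasSum_angPow (hn : 2 ≤ n) (hf : f ∈ angDomain n s) :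
    HasSum (fun k => (((1 + eigval n k) ^ (s / 2) : ℝ) : ℂ) • proj n (eigval n k) f)
      (angPow n s f) := by
  have hsum : Summable fun k =>
      (((1 + eigval n k) ^ (s / 2) : ℝ) : ℂ) • proj n (eigval n k) f := by
    refine ((orthogonalFamily_eigenspace hn).summable_iff_norm_sq_summable
      fun k => ⟨_, Submodule.smul_mem _ _ (proj_mem (eigval n k) f)⟩).2 ?_
    simp only [Submodule.coe_norm, norm_rpow_smul_proj_sq hn]
    exact (mem_angDomain_iff hn).1 hf
  have htsum : angPow n s f =
      ∑' k, (((1 + eigval n k) ^ (s / 2) : ℝ) : ℂ) • proj n (eigval n k) f := by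
    rw [angPow, ← (eigvalNN_injective hn).tsum_eq]
    · rfl
    · intro lam hlam
      by_contra h
      exact hlam (by simp [proj_eq_zero_of_notMem_range_eigvalNN hn h])
  exact htsum ▸ hsum.hasSum

theorem proj_angPow (hn : 2 ≤ n) (hf : f ∈ angDomain n s) (j : ℕ) :
    proj n (eigval n j) (angPow n s f) =
      (((1 + eigval n j) ^ (s / 2) : ℝ) : ℂ) • proj n (eigval n j) f :=
  proj_eigval_eq_of_hasSum hn (hasSum_angPow hn hf)
    (fun _ => Submodule.smul_mem _ _ (proj_mem _ _)) j

theorem enorm_rpow_smul_proj_sq (hn : 2 ≤ n) (s : ℝ) (f : L2Sph n) (k : ℕ) :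
    ‖(((1 + eigval n k) ^ (s / 2) : ℝ) : ℂ) • proj n (eigval n k) f‖ₑ ^ 2 =
      ENNReal.ofReal ((1 + eigval n k) ^ s) * ‖proj n (eigval n k) f‖ₑ ^ 2 := by
  have hpos := one_add_eigval_pos hn k
  rw [← ofReal_norm, ← ENNReal.ofReal_pow (norm_nonneg _), norm_rpow_smul_proj_sq hn,
    ENNReal.ofReal_mul (by positivity), ENNReal.ofReal_pow (norm_nonneg _), ofReal_norm]

theorem enorm_angPow_sq (hn : 2 ≤ n) (hf : f ∈ angDomain n s) :
    ‖angPow n s f‖ₑ ^ 2 =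
      ∑' k, ENNReal.ofReal ((1 + eigval n k) ^ s) * ‖proj n (eigval n k) f‖ₑ ^ 2 := by
  rw [enorm_sq_eq_tsum hn]
  exact tsum_congr fun k => by rw [proj_angPow hn hf, enorm_rpow_smul_proj_sq hn]

theorem sobNorm_sq (hn : 2 ≤ n) (s : ℝ) (f : L2Sph n) :
    sobNorm n s f ^ 2 =
      ∑' k, ENNReal.ofReal ((1 + eigval n k) ^ s) * ‖proj n (eigval n k) f‖ₑ ^ 2 := by
  rw [sobNorm]
  split_ifs with hf
  · exact enorm_angPow_sq hn hf
  · rw [ENNReal.top_pow two_ne_zero]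
    by_contra hne
    refine hf ((mem_angDomain_iff hn).2
      ((ENNReal.summable_toReal (Ne.symm hne)).congr fun k => ?_))
    have hpos := one_add_eigval_pos hn k
    rw [ENNReal.toReal_mul, ENNReal.toReal_ofReal (by positivity), ENNReal.toReal_pow,
      toReal_enorm]

theorem sobNorm_zero_right (hn : 2 ≤ n) (f : L2Sph n) : sobNorm n 0 f = ‖f‖ₑ := by
  have h := sobNorm_sq hn 0 f
  simp only [Real.rpow_zero, ENNReal.ofReal_one, one_mul] at h
  rw [← enorm_sq_eq_tsum hn] at h
  exact (ENNReal.pow_right_strictMono two_ne_zero).injective h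

end SphericalHarmonicExpansion

section PolarCoordinates

theorem lintegral_eq_lintegral_toSphere {E : Type*} [NormedAddCommGroup E] [NormedSpace ℝ E]
    [FiniteDimensional ℝ E] [Nontrivial E] [MeasurableSpace E] [BorelSpace E] (μ : Measure E)
    [μ.IsAddHaarMeasure] {f : E → ℝ≥0∞} (hf : Measurable f) :
    ∫⁻ x, f x ∂μ = ∫⁻ r in Ioi (0 : ℝ),
      (∫⁻ ω, f (r • (ω : E)) ∂μ.toSphere) *
        ENNReal.ofReal (r ^ (Module.finrank ℝ E - 1)) := by
  have hfsmul : Measurable fun q : Metric.sphere (0 : E) 1 × Ioi (0 : ℝ) =>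
      f ((q.2 : ℝ) • (q.1 : E)) := hf.comp (by fun_prop)
  calc ∫⁻ x, f x ∂μ = ∫⁻ x : ({0}ᶜ : Set E), f x ∂(μ.comap Subtype.val) := by
        rw [lintegral_subtype_comap (measurableSet_singleton _).compl, restrict_compl_singleton]
    _ = ∫⁻ q, f ((q.2 : ℝ) • (q.1 : E))
          ∂(μ.toSphere.prod (Measure.volumeIoiPow (Module.finrank ℝ E - 1))) := by
        rw [← μ.measurePreserving_homeomorphUnitSphereProd.lintegral_comp hfsmul]
        refine lintegral_congr fun x => ?_
        have hx : (x : E) ≠ 0 := x.2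
        simp [smul_smul, hx]
    _ = ∫⁻ r, ∫⁻ ω, f ((r : ℝ) • (ω : E)) ∂μ.toSphere
          ∂(Measure.volumeIoiPow (Module.finrank ℝ E - 1)) :=
        lintegral_prod_symm _ hfsmul.aemeasurable
    _ = _ := by
        rw [Measure.volumeIoiPow, lintegral_withDensity_eq_lintegral_mul _ (by fun_prop)
          hfsmul.lintegral_prod_left', ← lintegral_subtype_comap measurableSet_Ioi]
        exact lintegral_congr fun r => mul_comm _ _

theorem rpow_half_sq (a : ℝ≥0∞) : (a ^ (1 / 2 : ℝ)) ^ 2 = a := by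
  rw [← ENNReal.rpow_natCast, ← ENNReal.rpow_mul]
  norm_num

theorem eLpNorm_two_sq {α E : Type*} [MeasurableSpace α] [NormedAddCommGroup E] (μ : Measure α)
    (f : α → E) : eLpNorm f 2 μ ^ 2 = ∫⁻ x, ‖f x‖ₑ ^ 2 ∂μ := by
  simpa using eLpNorm_nnreal_pow_eq_lintegral (f := f) (μ := μ) (p := 2) two_ne_zero

end PolarCoordinates

section FourierTransform

variable {n k : ℕ} {p : MvPolynomial (Fin n) ℝ} {r : ℝ}

theorem continuous_planeWave :
    Continuous fun q : EuclideanSpace ℝ (Fin n) × Sph n => planeWave q.1 q.2 := by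
  unfold planeWave
  fun_prop

theorem norm_planeWave (x : EuclideanSpace ℝ (Fin n)) (ω : Sph n) : ‖planeWave x ω‖ = 1 := by
  rw [planeWave, Complex.norm_exp]
  simp

theorem planeWave_smul_comm (r : ℝ) (θ ω : Sph n) :
    planeWave (r • θ.1) ω = planeWave (r • ω.1) θ := by
  rw [planeWave, planeWave, real_inner_smul_left, real_inner_smul_left, real_inner_comm]

theorem integrable_L2Sph (g : L2Sph n) : Integrable g (surf n) :=
  (Lp.memLp g).integrable one_le_two

theorem continuous_fourierSurf (g : L2Sph n) : Continuous (fourierSurf g) := by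
  refine continuous_of_dominated (bound := fun ω => ‖g ω‖) (fun x => ?_) (fun x => ?_)
    (integrable_L2Sph g).norm (Eventually.of_forall fun ω => ?_)
  · exact (continuous_planeWave.comp (.prodMk_right x)).aestronglyMeasurable.mul
      (Lp.aestronglyMeasurable g)
  · exact Eventually.of_forall fun ω => by rw [norm_mul, norm_planeWave, one_mul]
  · exact (continuous_planeWave.comp (.prodMk_left ω)).mul continuous_const

/-- The restriction of the Fourier transform of `g dσ` to the sphere of radius `r`, rescaled to the
unit sphere. -/
def fourierSph (r : ℝ) (g : L2Sph n) : L2Sph n :=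
  ContinuousMap.toLp (E := ℂ) 2 (surf n) ℂ
    ⟨fun θ => fourierSurf g (r • θ.1), (continuous_fourierSurf g).comp (by fun_prop)⟩

theorem coeFn_fourierSph (r : ℝ) (g : L2Sph n) :
    fourierSph r g =ᵐ[surf n] fun θ => fourierSurf g (r • θ.1) :=
  ContinuousMap.coeFn_toLp (p := 2) (𝕜 := ℂ) (surf n) _

theorem integrable_polyFun_mul_planeWave_mul (p : MvPolynomial (Fin n) ℝ) (r : ℝ) (g : L2Sph n) :
    Integrable (Function.uncurry fun θ ω : Sph n => polyFun p θ * planeWave (r • θ.1) ω * g ω)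
      ((surf n).prod (surf n)) := by
  have hcont : Continuous fun q : Sph n × Sph n => polyFun p q.1 * planeWave (r • q.1.1) q.2 := by
    have hp := continuous_polyFun p
    unfold planeWave
    fun_prop
  obtain ⟨M, hM⟩ := (isCompact_univ (X := Sph n × Sph n)).exists_bound_of_continuousOn
    hcont.continuousOn
  exact ((integrable_L2Sph g).comp_snd (surf n)).bdd_mul hcont.aestronglyMeasurable
    (Eventually.of_forall fun q => hM q (mem_univ q))

theorem inner_polyL2_fourierSph (hn : 2 ≤ n) (hp : p ∈ solidHarmonics (Fin n) ℝ k) (r : ℝ)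
    (g : L2Sph n) :
    inner ℂ (polyL2 n p) (fourierSph r g) =
      sphArea n * ((-Complex.I) ^ k * radialBessel n k r) * inner ℂ (polyL2 n p) g := by
  rw [inner_polyL2_left, inner_polyL2_left, ← integral_const_mul]
  calc ∫ θ : Sph n, polyFun p θ * fourierSph r g θ ∂(surf n)
      = ∫ θ : Sph n, ∫ ω : Sph n, polyFun p θ * planeWave (r • θ.1) ω * g ω
          ∂(surf n) ∂(surf n) := by
        refine integral_congr_ae ((coeFn_fourierSph r g).mono fun θ hθ => ?_)
        simp only [hθ, fourierSurf, mul_assoc, integral_const_mul]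
    _ = ∫ ω : Sph n, ∫ θ : Sph n, polyFun p θ * planeWave (r • θ.1) ω * g ω ∂(surf n) ∂(surf n) :=
        integral_integral_swap (integrable_polyFun_mul_planeWave_mul p r g)
    _ = _ := by
        refine integral_congr_ae (Eventually.of_forall fun ω => ?_)
        simp only [integral_mul_const, planeWave_smul_comm r _ ω, mul_comm (polyFun p _),
          integral_planeWave_mul_polyFun hn hp r ω]
        ring

theorem proj_fourierSph (hn : 2 ≤ n) (hr : 0 < r) (g : L2Sph n) (k : ℕ) :
    proj n (eigval n k) (fourierSph r g) =
      (-Complex.I) ^ k • (((2 * Real.pi) ^ ((n : ℝ) / 2) * r ^ (1 - (n : ℝ) / 2) *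
        besselJ (besselOrder n k) r : ℝ) : ℂ) • proj n (eigval n k) g := by
  rw [← sphArea_mul_radialBessel hn k hr, ← sub_eq_zero]
  refine eq_zero_of_inner_solidHarmonics fun l p hp => ?_
  rcases eq_or_ne l k with rfl | hl
  · rw [inner_sub_right, inner_smul_right, inner_smul_right, inner_polyL2_proj_self hp,
      inner_polyL2_proj_self hp, inner_polyL2_fourierSph hn hp]
    push_cast
    ring
  · exact inner_polyL2_eq_zero hp ((eigval_injective hn).ne hl.symm)
      (sub_mem (proj_mem _ _) (Submodule.smul_mem _ _
        (Submodule.smul_mem _ _ (proj_mem _ _))))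

theorem weighted_smul_ae_eq (b : ℝ) (hr : 0 < r) (g : L2Sph n) :
    (fun ω : Sph n => weighted b (fourierSurf g) (r • ω.1)) =ᵐ[surf n]
      (((r ^ (-b / 2) : ℝ) : ℂ) • fourierSph r g : L2Sph n) := by
  filter_upwards [coeFn_fourierSph r g,
    Lp.coeFn_smul ((r ^ (-b / 2) : ℝ) : ℂ) (fourierSph r g)] with ω hfourier hsmul
  rw [hsmul, Pi.smul_apply, hfourier, weighted, norm_smul, norm_eq_of_mem_sphere, mul_one,
    Real.norm_of_nonneg hr.le, smul_eq_mul]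

theorem sobNormFun_eq_sobNorm {F : Sph n → ℂ} {f : L2Sph n} (s : ℝ) (hF : F =ᵐ[surf n] f) :
    sobNormFun n s F = sobNorm n s f := by
  have hmem : MemLp F 2 (surf n) := (Lp.memLp f).ae_eq hF.symm
  rw [sobNormFun, dif_pos hmem, Lp.ext (hmem.coeFn_toLp.trans hF)]

theorem enorm_ofReal_smul_sq {E : Type*} [NormedAddCommGroup E] [NormedSpace ℂ E] (a : ℝ) (f : E) :
    ‖(a : ℂ) • f‖ₑ ^ 2 = ENNReal.ofReal (a ^ 2) * ‖f‖ₑ ^ 2 := by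
  rw [enorm_smul, mul_pow, ← ofReal_norm (a : ℂ), ← ENNReal.ofReal_pow (norm_nonneg _),
    Complex.norm_real, Real.norm_eq_abs, sq_abs]

theorem sobNormFun_weighted_sq_mul (hn : 2 ≤ n) (s b : ℝ) (hr : 0 < r) (g : L2Sph n) :
    sobNormFun n s (fun ω : Sph n => weighted b (fourierSurf g) (r • ω.1)) ^ 2 *
        ENNReal.ofReal (r ^ (n - 1)) =
      ∑' k, ENNReal.ofReal ((2 * Real.pi) ^ n) * (ENNReal.ofReal ((1 + eigval n k) ^ s) *
        ‖proj n (eigval n k) g‖ₑ ^ 2) *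
          ENNReal.ofReal (r ^ (1 - b) * besselJ (besselOrder n k) r ^ 2) := by
  have hscalar (k : ℕ) : (r ^ (-b / 2)) ^ 2 * ((2 * Real.pi) ^ ((n : ℝ) / 2) *
      r ^ (1 - (n : ℝ) / 2) * besselJ (besselOrder n k) r) ^ 2 * r ^ (n - 1) =
      (2 * Real.pi) ^ n * (r ^ (1 - b) * besselJ (besselOrder n k) r ^ 2) := by
    have hpi : ((2 * Real.pi) ^ ((n : ℝ) / 2)) ^ 2 = (2 * Real.pi) ^ n := by
      rw [← Real.rpow_mul_natCast (by positivity), Nat.cast_ofNat,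
        div_mul_cancel₀ _ two_ne_zero, Real.rpow_natCast]
    have hpow : (r ^ (-b / 2)) ^ 2 * (r ^ (1 - (n : ℝ) / 2)) ^ 2 * r ^ (n - 1) = r ^ (1 - b) := by
      rw [← Real.rpow_natCast r, Nat.cast_sub (by omega), ← Real.rpow_mul_natCast hr.le,
        ← Real.rpow_mul_natCast hr.le, ← Real.rpow_add hr, ← Real.rpow_add hr]
      push_cast
      ring_nf
    rw [← hpi, ← hpow]
    ring
  have hI (k : ℕ) : ‖(-Complex.I) ^ k‖ₑ = 1 := by
    rw [← ofReal_norm, norm_pow, norm_neg, Complex.norm_I, one_pow, ENNReal.ofReal_one]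
  rw [sobNormFun_eq_sobNorm s (weighted_smul_ae_eq b hr g), sobNorm_sq hn, ← ENNReal.tsum_mul_right]
  refine tsum_congr fun k => ?_
  rw [map_smul, proj_fourierSph hn hr, enorm_ofReal_smul_sq, enorm_smul, hI, one_mul,
    enorm_ofReal_smul_sq]
  calc _ = ENNReal.ofReal ((r ^ (-b / 2)) ^ 2 * ((2 * Real.pi) ^ ((n : ℝ) / 2) *
        r ^ (1 - (n : ℝ) / 2) * besselJ (besselOrder n k) r) ^ 2 * r ^ (n - 1)) *
          (ENNReal.ofReal ((1 + eigval n k) ^ s) * ‖proj n (eigval n k) g‖ₑ ^ 2) := by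
        rw [ENNReal.ofReal_mul (by positivity), ENNReal.ofReal_mul (by positivity)]
        ring
    _ = _ := by
        rw [hscalar, ENNReal.ofReal_mul (by positivity)]
        ring

theorem angL2Norm_weighted_sq (hn : 2 ≤ n) (s b : ℝ) (g : L2Sph n) :
    angL2Norm n s (weighted b (fourierSurf g)) ^ 2 =
      ENNReal.ofReal ((2 * Real.pi) ^ n) * ∑' k, ENNReal.ofReal ((1 + eigval n k) ^ s) *
        besselMoment b (besselOrder n k) * ‖proj n (eigval n k) g‖ₑ ^ 2 := by
  have hmeas (k : ℕ) := (measurable_rpow_mul_besselJ_sq (1 - b) (besselOrder n k)).ennreal_ofReal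
  rw [angL2Norm, rpow_half_sq, setLIntegral_congr_fun measurableSet_Ioi
    fun r hr => sobNormFun_weighted_sq_mul hn s b hr g, lintegral_tsum fun k =>
      ((hmeas k).const_mul _).aemeasurable, ← ENNReal.tsum_mul_left]
  refine tsum_congr fun k => ?_
  rw [lintegral_const_mul _ (hmeas k), besselMoment]
  ring

theorem measurable_weighted (b : ℝ) (g : L2Sph n) : Measurable (weighted b (fourierSurf g)) :=
  (Complex.measurable_ofReal.comp (measurable_norm.pow_const _)).mul
    (continuous_fourierSurf g).measurable

theorem eLpNorm_weighted_eq_angL2Norm (hn : 2 ≤ n) (b : ℝ) (g : L2Sph n) :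
    eLpNorm (weighted b (fourierSurf g)) 2 volume =
      angL2Norm n 0 (weighted b (fourierSurf g)) := by
  have : Nonempty (Fin n) := ⟨⟨0, by omega⟩⟩
  refine (ENNReal.pow_right_strictMono two_ne_zero).injective ?_
  rw [eLpNorm_two_sq, lintegral_eq_lintegral_toSphere _
    ((measurable_weighted b g).enorm.pow_const 2), angL2Norm, rpow_half_sq,
    finrank_euclideanSpace_fin]
  refine setLIntegral_congr_fun measurableSet_Ioi fun r hr => ?_
  have hae := weighted_smul_ae_eq b hr g
  rw [sobNormFun_eq_sobNorm 0 hae, sobNorm_zero_right hn, Lp.enorm_def, ← eLpNorm_congr_ae hae,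
    eLpNorm_two_sq]

end FourierTransform

section Duality

variable {n k : ℕ}

theorem inner_star_left (u v : L2Sph n) : inner ℂ (star u) v = ∫ ω, u ω * v ω ∂(surf n) := by
  rw [L2.inner_def]
  refine integral_congr_ae ((Lp.coeFn_star u).mono fun ω hω => ?_)
  simp only [hω, RCLike.inner_apply, Pi.star_apply, RCLike.star_def, Complex.conj_conj, mul_comm]

theorem inner_star_comm (u v : L2Sph n) : inner ℂ (star u) v = inner ℂ (star v) u := by
  simp only [inner_star_left, mul_comm]

theorem inner_polyL2_star (p : MvPolynomial (Fin n) ℝ) (f : L2Sph n) :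
    inner ℂ (polyL2 n p) (star f) = (starRingEnd ℂ) (inner ℂ (polyL2 n p) f) := by
  rw [inner_polyL2_left, inner_polyL2_left, ← integral_conj]
  refine integral_congr_ae ((Lp.coeFn_star f).mono fun ω hω => ?_)
  simp only [hω, Pi.star_apply, RCLike.star_def, map_mul, polyFun_apply, Complex.conj_ofReal]

theorem proj_star (hn : 2 ≤ n) (k : ℕ) (f : L2Sph n) :
    proj n (eigval n k) (star f) = star (proj n (eigval n k) f) := by
  rw [← sub_eq_zero]
  refine eq_zero_of_inner_solidHarmonics fun l p hp => ?_
  rw [inner_sub_right, inner_polyL2_star]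
  rcases eq_or_ne l k with rfl | hl
  · rw [inner_polyL2_proj_self hp, inner_polyL2_proj_self hp, inner_polyL2_star, sub_self]
  · have hne := (eigval_injective hn).ne hl.symm
    rw [inner_polyL2_eq_zero hp hne (proj_mem _ _), inner_polyL2_eq_zero hp hne (proj_mem _ _),
      map_zero, sub_zero]

theorem fourierSurf_eq_inner (g : L2Sph n) (x : EuclideanSpace ℝ (Fin n)) :
    fourierSurf g x = inner ℂ (star g) (planeWaveL2 x) := by
  rw [inner_star_comm, inner_star_left, fourierSurf]
  refine integral_congr_ae ((memLp_planeWave x).coeFn_toLp.mono fun ω hω => ?_)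
  simp only [planeWaveL2, hω]

theorem fourierSurfSob_eq_inner (s : ℝ) (h : L2Sph n) (x : EuclideanSpace ℝ (Fin n)) :
    fourierSurfSob s h x = inner ℂ (star h) (angPow n (-s) (planeWaveL2 x)) := by
  rw [inner_star_comm, inner_star_left, fourierSurfSob]

end Duality

section SmoothFunctions

variable {n : ℕ} {φ : EuclideanSpace ℝ (Fin n) → ℂ}

/-- The class in `L²(S^{n-1})` of the restriction of a smooth function to the sphere. -/
def smoothL2 (hφ : ContDiff ℝ (⊤ : ℕ∞) φ) : L2Sph n :=
  ContinuousMap.toLp (E := ℂ) 2 (surf n) ℂ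
    ⟨fun ω => φ ω, hφ.continuous.comp continuous_subtype_val⟩

theorem coeFn_smoothL2 (hφ : ContDiff ℝ (⊤ : ℕ∞) φ) : smoothL2 hφ =ᵐ[surf n] fun ω => φ ω :=
  ContinuousMap.coeFn_toLp (p := 2) (𝕜 := ℂ) (surf n) _

theorem proj_eq_zero_of_mem_shiftedRange {lam : ℝ} {u : L2Sph n} (hu : u ∈ shiftedRange n lam) :
    proj n lam u = 0 :=
  (Submodule.starProjection_apply_eq_zero_iff _).2 <|
    Submodule.le_orthogonal_orthogonal _ (Submodule.subset_span hu)

theorem contDiff_one_sub_lapBeltrami (hφ : ContDiff ℝ (⊤ : ℕ∞) φ) :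
    ContDiff ℝ (⊤ : ℕ∞) fun x => φ x - lapBeltrami φ x :=
  hφ.sub (contDiff_lapBeltrami hφ)

theorem proj_smoothL2_one_sub_lapBeltrami (hφ : ContDiff ℝ (⊤ : ℕ∞) φ) (lam : ℝ) :
    proj n lam (smoothL2 (contDiff_one_sub_lapBeltrami hφ)) =
      ((1 + lam : ℝ) : ℂ) • proj n lam (smoothL2 hφ) := by
  set ψ := smoothL2 (contDiff_one_sub_lapBeltrami hφ) with hψ
  have hmem : ((1 + lam : ℝ) : ℂ) • smoothL2 hφ - ψ ∈ shiftedRange n lam := by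
    refine ⟨φ, hφ, ?_⟩
    filter_upwards [Lp.coeFn_sub (((1 + lam : ℝ) : ℂ) • smoothL2 hφ) ψ,
      Lp.coeFn_smul ((1 + lam : ℝ) : ℂ) (smoothL2 hφ), coeFn_smoothL2 hφ,
      coeFn_smoothL2 (contDiff_one_sub_lapBeltrami hφ)] with ω hsub hsmul hφω hψω
    rw [hsub, Pi.sub_apply, hsmul, Pi.smul_apply, hφω, hψ, hψω, smul_eq_mul]
    push_cast
    ring
  have hzero := proj_eq_zero_of_mem_shiftedRange hmem
  rw [map_sub, map_smul, sub_eq_zero] at hzero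
  exact hzero.symm

theorem summable_pow_mul_norm_sq_proj_smoothL2 (hn : 2 ≤ n) (N : ℕ)
    (hφ : ContDiff ℝ (⊤ : ℕ∞) φ) :
    Summable fun k => (1 + eigval n k) ^ (2 * N) * ‖proj n (eigval n k) (smoothL2 hφ)‖ ^ 2 := by
  induction N generalizing φ with
  | zero => simpa using (hasSum_norm_sq_proj hn (smoothL2 hφ)).summable
  | succ N ih =>
    refine (ih (contDiff_one_sub_lapBeltrami hφ)).congr fun k => ?_
    rw [proj_smoothL2_one_sub_lapBeltrami hφ, norm_smul, Complex.norm_real,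
      Real.norm_of_nonneg (one_add_eigval_pos hn k).le]
    ring

theorem smoothL2_mem_angDomain (hn : 2 ≤ n) (s : ℝ) (hφ : ContDiff ℝ (⊤ : ℕ∞) φ) :
    smoothL2 hφ ∈ angDomain n s := by
  obtain ⟨N, hsN⟩ := exists_nat_ge (s / 2)
  rw [mem_angDomain_iff hn]
  refine (summable_pow_mul_norm_sq_proj_smoothL2 hn N hφ).of_nonneg_of_le (fun k => ?_) fun k => ?_
  · have := one_add_eigval_pos hn k
    positivity
  · gcongr
    rw [← Real.rpow_natCast]
    refine Real.rpow_le_rpow_of_exponent_le (by linarith [eigval_nonneg hn k]) ?_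
    push_cast
    linarith

theorem planeWaveL2_mem_angDomain (hn : 2 ≤ n) (s : ℝ) (x : EuclideanSpace ℝ (Fin n)) :
    planeWaveL2 x ∈ angDomain n s :=
  smoothL2_mem_angDomain hn s (φ := fun y => Complex.exp (-(Complex.I * (inner ℝ x y : ℝ))))
    ((contDiff_const.mul (Complex.ofRealCLM.contDiff.comp
      (contDiff_const.inner ℝ contDiff_id))).neg).cexp

end SmoothFunctions

section Truncation

variable {n : ℕ}

/-- The truncation of `Λ_ω^s h` to spherical harmonics of degree less than `K`, an element of
`L²(S^{n-1})` even where `Λ_ω^s h` is only a distribution. -/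
def angPowPartial (n : ℕ) (s : ℝ) (h : L2Sph n) (K : ℕ) : L2Sph n :=
  ∑ k ∈ Finset.range K, (((1 + eigval n k) ^ (s / 2) : ℝ) : ℂ) • proj n (eigval n k) h

theorem proj_angPowPartial (hn : 2 ≤ n) (s : ℝ) (h : L2Sph n) (K j : ℕ) :
    proj n (eigval n j) (angPowPartial n s h K) =
      if j < K then (((1 + eigval n j) ^ (s / 2) : ℝ) : ℂ) • proj n (eigval n j) h else 0 := by
  simp only [angPowPartial, map_sum, map_smul, ← Finset.mem_range,
    ← Finset.sum_ite_eq' (Finset.range K) j fun k =>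
      (((1 + eigval n k) ^ (s / 2) : ℝ) : ℂ) • proj n (eigval n k) h]
  refine Finset.sum_congr rfl fun k _ => ?_
  split_ifs with hkj
  · rw [hkj, proj_eq_self (proj_mem _ _)]
  · rw [proj_eq_zero_of_mem ((eigval_injective hn).ne (Ne.symm hkj)) (proj_mem _ _), smul_zero]

theorem sobNorm_angPowPartial_neg_le (hn : 2 ≤ n) (s : ℝ) (h : L2Sph n) (K : ℕ) :
    sobNorm n s (angPowPartial n (-s) h K) ≤ ‖h‖ₑ := by
  rw [← (ENNReal.pow_right_strictMono two_ne_zero).le_iff_le, sobNorm_sq hn, enorm_sq_eq_tsum hn]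
  refine ENNReal.tsum_le_tsum fun j => ?_
  rw [proj_angPowPartial hn]
  split_ifs
  · have hpos := one_add_eigval_pos hn j
    rw [enorm_rpow_smul_proj_sq hn, ← mul_assoc, ← ENNReal.ofReal_mul (by positivity),
      ← Real.rpow_add hpos, add_neg_cancel, Real.rpow_zero, ENNReal.ofReal_one, one_mul]
  · simp

theorem tendsto_fourierSurf_angPowPartial (hn : 2 ≤ n) (s : ℝ) (h : L2Sph n)
    (x : EuclideanSpace ℝ (Fin n)) :
    Tendsto (fun K => fourierSurf (angPowPartial n (-s) h K) x) atTop
      (𝓝 (fourierSurfSob s h x)) := by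
  have hsum := (hasSum_angPow hn (planeWaveL2_mem_angDomain hn (-s) x)).mapL (innerSL ℂ (star h))
  rw [fourierSurfSob_eq_inner]
  refine hsum.tendsto_sum_nat.congr fun K => ?_
  rw [fourierSurf_eq_inner, inner_star_comm, angPowPartial, inner_sum]
  refine Finset.sum_congr rfl fun k _ => ?_
  rw [innerSL_apply_apply, inner_smul_right, inner_smul_right, ← inner_proj_left, proj_star hn,
    inner_star_comm]

theorem eLpNorm_weighted_fourierSurfSob_le (hn : 2 ≤ n) (b s : ℝ) {C : ℝ≥0∞}
    (hC : ∀ g : L2Sph n, eLpNorm (weighted b (fourierSurf g)) 2 volume ≤ C * sobNorm n s g)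
    (h : L2Sph n) : eLpNorm (weighted b (fourierSurfSob s h)) 2 volume ≤ C * ‖h‖ₑ := by
  refine (Lp.eLpNorm_lim_le_liminf_eLpNorm
    (f := fun K => weighted b (fourierSurf (angPowPartial n (-s) h K)))
    (fun K => (measurable_weighted b _).aestronglyMeasurable) _
    (Eventually.of_forall fun x =>
      (tendsto_fourierSurf_angPowPartial hn s h x).const_mul _)).trans ?_
  exact liminf_le_of_frequently_le' (Frequently.of_forall fun K =>
    (hC _).trans (mul_le_mul_right (sobNorm_angPowPartial_neg_le hn s h K) C))

end Truncation

section TestHarmonics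

open MvPolynomial

variable {n k : ℕ} {p : MvPolynomial (Fin n) ℝ}

theorem polyL2_ne_zero {ω : Sph n} (h : polyFun p ω ≠ 0) : polyL2 n p ≠ 0 := by
  intro hzero
  have hae : (fun ω : Sph n => polyFun p ω) =ᵐ[surf n] fun _ => 0 :=
    (coeFn_polyL2 p).symm.trans (hzero ▸ Lp.coeFn_zero ℂ 2 (surf n))
  have heq := (((continuous_polyFun p).comp continuous_subtype_val).ae_eq_iff_eq (surf n)
    continuous_const).1 hae
  exact h (congrFun heq ω)

theorem exists_mem_solidHarmonics_polyL2_ne_zero (hn : 2 ≤ n) (hk : k < 2) :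
    ∃ p ∈ solidHarmonics (Fin n) ℝ k, polyL2 n p ≠ 0 := by
  let i : Fin n := ⟨0, by omega⟩
  let ω : Sph n := ⟨EuclideanSpace.single i 1, by simp⟩
  interval_cases k
  · exact ⟨C 1, C_mem_solidHarmonics 1, polyL2_ne_zero (ω := ω) (by simp)⟩
  · exact ⟨X i, X_mem_solidHarmonics i, polyL2_ne_zero (ω := ω) (by simp [polyFun_X, ω])⟩

theorem sobNorm_polyL2_ne_top (hn : 2 ≤ n) (hp : p ∈ solidHarmonics (Fin n) ℝ k) (s : ℝ) :
    sobNorm n s (polyL2 n p) ≠ ⊤ := by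
  suffices hsq : sobNorm n s (polyL2 n p) ^ 2 ≠ ⊤ from
    (ENNReal.pow_ne_top_iff.1 hsq).resolve_right two_ne_zero
  rw [sobNorm_sq hn, tsum_eq_single k fun j hj => by
    rw [proj_eq_zero_of_mem ((eigval_injective hn).ne hj) (polyL2_mem_eigenspace hp)]
    simp]
  exact ENNReal.mul_ne_top ENNReal.ofReal_ne_top (ENNReal.pow_ne_top enorm_ne_top)

theorem besselMoment_ne_top_of_angL2Norm (hn : 2 ≤ n) {b s : ℝ}
    (hp : p ∈ solidHarmonics (Fin n) ℝ k) (hne : polyL2 n p ≠ 0)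
    (hfin : angL2Norm n s (weighted b (fourierSurf (polyL2 n p))) ≠ ⊤) :
    besselMoment b (besselOrder n k) ≠ ⊤ := by
  intro htop
  have hsq := angL2Norm_weighted_sq hn s b (polyL2 n p)
  have hpos := one_add_eigval_pos hn k
  rw [ENNReal.tsum_eq_top_of_eq_top ⟨k, ?_⟩,
    ENNReal.mul_top (ENNReal.ofReal_pos.2 (by positivity)).ne'] at hsq
  · exact ENNReal.pow_ne_top hfin hsq
  · rw [proj_eq_self (polyL2_mem_eigenspace hp), htop, ENNReal.mul_top, ENNReal.top_mul]
    · exact pow_ne_zero 2 (enorm_ne_zero.2 hne)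
    · exact (ENNReal.ofReal_pos.2 (by positivity)).ne'

end TestHarmonics

section TraceEstimates

variable {n : ℕ} {b s t : ℝ}

theorem sobNorm_mono (hn : 2 ≤ n) (hst : s ≤ t) (f : L2Sph n) :
    sobNorm n s f ≤ sobNorm n t f := by
  rw [← (ENNReal.pow_right_strictMono two_ne_zero).le_iff_le, sobNorm_sq hn, sobNorm_sq hn]
  gcongr with k
  linarith [eigval_nonneg hn k]

theorem ofReal_sqrt_mul_sq (a : ℝ) (x : ℝ≥0∞) :
    (ENNReal.ofReal √a * x) ^ 2 = ENNReal.ofReal a * x ^ 2 := by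
  rcases le_total 0 a with ha | ha
  · rw [mul_pow, ← ENNReal.ofReal_pow (Real.sqrt_nonneg a), Real.sq_sqrt ha]
  · simp [Real.sqrt_eq_zero_of_nonpos ha, ENNReal.ofReal_of_nonpos ha]

theorem exists_angL2Norm_weighted_bounds (hn : 2 ≤ n) (hb : 1 < b) (hbn : b < n) :
    ∃ c C : ℝ, 0 < c ∧ 0 < C ∧ ∀ (s : ℝ) (g : L2Sph n),
      ENNReal.ofReal c * sobNorm n s g ≤
        angL2Norm n (s + (b - 1) / 2) (weighted b (fourierSurf g)) ∧
      angL2Norm n (s + (b - 1) / 2) (weighted b (fourierSurf g)) ≤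
        ENNReal.ofReal C * sobNorm n s g := by
  obtain ⟨c, hc, C, hC, hM⟩ := exists_besselMoment_bounds hn hb hbn
  have hsq {x y : ℝ≥0∞} (h : x ^ 2 ≤ y ^ 2) : x ≤ y :=
    (ENNReal.pow_right_strictMono two_ne_zero).le_iff_le.1 h
  have hang (s : ℝ) (g : L2Sph n) :
      angL2Norm n (s + (b - 1) / 2) (weighted b (fourierSurf g)) ^ 2 =
        ENNReal.ofReal ((2 * Real.pi) ^ n) * ∑' k,
          ENNReal.ofReal ((1 + eigval n k) ^ ((b - 1) / 2)) * besselMoment b (besselOrder n k) *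
            (ENNReal.ofReal ((1 + eigval n k) ^ s) * ‖proj n (eigval n k) g‖ₑ ^ 2) := by
    rw [angL2Norm_weighted_sq hn]
    congr 1
    refine tsum_congr fun k => ?_
    have hpos := one_add_eigval_pos hn k
    rw [Real.rpow_add hpos, ENNReal.ofReal_mul (by positivity)]
    ring
  have hsob (a s : ℝ) (g : L2Sph n) :
      (ENNReal.ofReal √((2 * Real.pi) ^ n * a) * sobNorm n s g) ^ 2 =
        ENNReal.ofReal ((2 * Real.pi) ^ n) * ∑' k, ENNReal.ofReal a *
          (ENNReal.ofReal ((1 + eigval n k) ^ s) * ‖proj n (eigval n k) g‖ₑ ^ 2) := by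
    rw [ofReal_sqrt_mul_sq, sobNorm_sq hn, ENNReal.ofReal_mul (by positivity), mul_assoc,
      ENNReal.tsum_mul_left]
  refine ⟨√((2 * Real.pi) ^ n * c), √((2 * Real.pi) ^ n * C), by positivity, by positivity,
    fun s g => ⟨hsq ?_, hsq ?_⟩⟩ <;> rw [hang, hsob] <;> gcongr with k
  exacts [(hM k).1, (hM k).2]

theorem one_lt_and_lt_of_angL2Norm_ne_top (hn : 2 ≤ n)
    (h : ∀ k, ∀ p ∈ solidHarmonics (Fin n) ℝ k,
      angL2Norm n s (weighted b (fourierSurf (polyL2 n p))) ≠ ⊤) : 1 < b ∧ b < n := by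
  have hmoment {k : ℕ} (hk : k < 2) : besselMoment b (besselOrder n k) ≠ ⊤ := by
    obtain ⟨p, hp, hne⟩ := exists_mem_solidHarmonics_polyL2_ne_zero hn hk
    exact besselMoment_ne_top_of_angL2Norm hn hp hne (h k p hp)
  have hν := besselOrder_nonneg hn 0
  refine ⟨one_lt_of_besselMoment_ne_top (by linarith) (hmoment two_pos)
    (besselOrder_succ n 0 ▸ hmoment one_lt_two), ?_⟩
  have hlt := lt_of_besselMoment_ne_top (by linarith) (hmoment two_pos)
  rw [besselOrder, Nat.cast_zero] at hlt
  linarith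

end TraceEstimates

end SphereTrace

end

open SphereTrace MeasureTheory

theorem theorem1p1 (n : ℕ) (hn : 2 ≤ n) (b : ℝ) :
    -- the two-sided estimate
    (1 < b → b < n →
      ∃ c C : ℝ, 0 < c ∧ 0 < C ∧ ∀ g : SphereTrace.L2Sph n,
        ENNReal.ofReal c * ‖g‖ₑ ≤
            SphereTrace.angL2Norm n ((b - 1) / 2)
              (SphereTrace.weighted b (SphereTrace.fourierSurf g)) ∧
          SphereTrace.angL2Norm n ((b - 1) / 2)
              (SphereTrace.weighted b (SphereTrace.fourierSurf g)) ≤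
            ENNReal.ofReal C * ‖g‖ₑ) ∧
    -- the estimate by the Sobolev norm of `g`, for `g` in `L²` and for all `g = Λ_ω^{-s} h` in `H^s`
    (1 < b → b < n →
      ∃ C : ℝ, 0 < C ∧ ∀ s : ℝ, (1 - b) / 2 ≤ s →
        (∀ g : SphereTrace.L2Sph n,
          MeasureTheory.eLpNorm (SphereTrace.weighted b (SphereTrace.fourierSurf g)) 2
              MeasureTheory.volume ≤
            ENNReal.ofReal C * SphereTrace.sobNorm n s g) ∧
        (∀ h : SphereTrace.L2Sph n,
          MeasureTheory.eLpNorm (SphereTrace.weighted b (SphereTrace.fourierSurfSob s h)) 2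
              MeasureTheory.volume ≤
            ENNReal.ofReal C * ‖h‖ₑ)) ∧
    -- the range of `b` is necessary, in the first estimate and in the second for any `s`
    ((∃ C : ℝ, ∀ g : SphereTrace.L2Sph n,
        SphereTrace.angL2Norm n ((b - 1) / 2)
            (SphereTrace.weighted b (SphereTrace.fourierSurf g)) ≤
          ENNReal.ofReal C * ‖g‖ₑ) → 1 < b ∧ b < n) ∧
    (∀ s : ℝ, (∃ C : ℝ, ∀ g : SphereTrace.L2Sph n,
        MeasureTheory.eLpNorm (SphereTrace.weighted b (SphereTrace.fourierSurf g)) 2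
            MeasureTheory.volume ≤
          ENNReal.ofReal C * SphereTrace.sobNorm n s g) → 1 < b ∧ b < n) := by
  refine ⟨fun hb hbn => ?_, fun hb hbn => ?_, fun ⟨C, hC⟩ => ?_, fun s ⟨C, hC⟩ => ?_⟩
  · obtain ⟨c, C, hc, hC, h⟩ := exists_angL2Norm_weighted_bounds hn hb hbn
    refine ⟨c, C, hc, hC, fun g => ?_⟩
    simpa only [zero_add, sobNorm_zero_right hn] using h 0 g
  · obtain ⟨_, C, _, hC, h⟩ := exists_angL2Norm_weighted_bounds hn hb hbn
    refine ⟨C, hC, fun s hs => ?_⟩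
    have hsob (g : L2Sph n) :
        eLpNorm (weighted b (fourierSurf g)) 2 volume ≤ ENNReal.ofReal C * sobNorm n s g := by
      rw [eLpNorm_weighted_eq_angL2Norm hn, ← show (1 - b) / 2 + (b - 1) / 2 = 0 by ring]
      exact (h _ g).2.trans (by gcongr; exact sobNorm_mono hn hs g)
    exact ⟨hsob, eLpNorm_weighted_fourierSurfSob_le hn b s hsob⟩
  · exact one_lt_and_lt_of_angL2Norm_ne_top hn fun k p _ =>
      ne_top_of_le_ne_top (ENNReal.mul_ne_top ENNReal.ofReal_ne_top enorm_ne_top) (hC (polyL2 n p))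
  · refine one_lt_and_lt_of_angL2Norm_ne_top (s := 0) hn fun k p hp => ?_
    rw [← eLpNorm_weighted_eq_angL2Norm hn]
    exact ne_top_of_le_ne_top (ENNReal.mul_ne_top ENNReal.ofReal_ne_top
      (sobNorm_polyL2_ne_top hn hp s)) (hC (polyL2 n p))
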